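/- For functions $f,g$ of $r>0$, with $f$ locally absolutely continuous and $g$ measurable, put $$\mathcal E(f,g)=\int_0^\infty\Big(g^2+f_r^2+\frac{\sin^2 f}{r^2}\Big)\,r\,dr,\qquad \|(f,g)\|_{H\times L^2}^2=\int_0^\infty\Big(g^2+f_r^2+\frac{f^2}{r^2}\Big)\,r\,dr ,$$ and for $n\in\mathbb Z$ let $\mathcal H_n$ be the set of pairs $(f,g)$ with $\mathcal E(f,g)<\infty$, $f(0)=\lim_{r\to0+}f(r)=0$ and $f(\infty)=\lim_{r\to\infty}f(r)=n\pi$; $\mathcal H=\bigcup_n\mathcal H_n$. Consider the equation for $1$-equivariant wave maps $\mathbb R^{1+2}\to\mathbb S^2$, $$\psi_{tt}-\psi_{rr}-\frac1r\psi_r+\frac{\sin(2\psi)}{2r^2}=0. \qquad (*)$$ A global wave map in $\mathcal H$ is a trajectory $\vec\psi(t)=(\psi(t),\psi_t(t))\in\mathcal H_n$, $t\ge 0$, for some $n\in\mathbb Z$, which on each interval $[0,T]$ is the limit, uniformly in $t\in[0,T]$ in the $H\times L^2$ distance, of classical solutions of $(*)$ with values in $\mathcal H_n$, where a classical solution is one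 that is $C^2$ on $[0,T]\times[0,\infty)$ up to the boundary (in particular, every classical solution on $[0,\infty)\times[0,\infty)$ with values in $\mathcal H_n$ is a global wave map). **Corollary 2.2.** Let $\vec\psi(t)\in\mathcal H$ be a global wave map. Then $$\limsup_{T\to\infty}\frac1T\int_A^T\int_0^{t-A}\psi_t^2(t,r)\,r\,dr\,dt\;\longrightarrow\;0\qquad\text{as }A\to\infty .$$ Moreover, for every nondecreasing function $A:(0,\infty)\to(0,\infty)$ with $A(t)\le t$ for all $t$ and $A(t)\to\infty$ as $t\to\infty$, there is a sequence of times $t_n\to\infty$ such that $$\lim_{n\to\infty}\ \sup_{\sigma>0}\ \frac1\sigma\int_{t_n}^{t_n+\sigma}\int_0^{t-A(t_n)}\psi_t^2(t,r)\,r\,dr\,dt=0 ,$$ where the inner integral is $0$ when $t\le A(t_n)$. -/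

import Mathlib

open MeasureTheory Set Filter Topology
open scoped ENNReal

/-- The energy `∫₀^∞ (g² + f_r² + sin²(f) / r²) r dr` of a pair `(f, g)` of functions of `r > 0`. -/
noncomputable def waveEnergy (f g : ℝ → ℝ) : ℝ≥0∞ :=
  ∫⁻ r in Ioi (0 : ℝ),
    ENNReal.ofReal ((g r ^ 2 + deriv f r ^ 2 + Real.sin (f r) ^ 2 / r ^ 2) * r)

/-- The square of the `H × L²` norm of a pair `(f, g)`: `∫₀^∞ (g² + f_r² + f² / r²) r dr`. -/
noncomputable def normHL2Sq (f g : ℝ → ℝ) : ℝ≥0∞ :=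
  ∫⁻ r in Ioi (0 : ℝ),
    ENNReal.ofReal ((g r ^ 2 + deriv f r ^ 2 + f r ^ 2 / r ^ 2) * r)

/-- The energy class `𝓗_n`: pairs `(f, g)` of finite energy with `f(0) = 0` and `f(∞) = n π`.
The weak derivative `f_r` is the almost everywhere derivative of the locally absolutely
continuous function `f`. -/
structure MemEnergyClass (n : ℤ) (f g : ℝ → ℝ) : Prop where
  absCont : ∀ a b : ℝ, 0 < a → a ≤ b → AbsolutelyContinuousOnInterval f a b
  aesm : AEStronglyMeasurable g (volume.restrict (Ioi (0 : ℝ)))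
  energy_lt_top : waveEnergy f g < ∞
  tendsto_zero : Tendsto f (𝓝[>] 0) (𝓝 0)
  tendsto_atTop : Tendsto f atTop (𝓝 (n * Real.pi))

/-- The time derivative `φ_t(t, r)`. -/
noncomputable def timeDeriv (φ : ℝ → ℝ → ℝ) (t r : ℝ) : ℝ :=
  deriv (fun s => φ s r) t

/-- `φ(t, r)` is a classical solution on `[0, T]`, of class `𝓗_n`, of
`φ_tt - φ_rr - φ_r / r + sin(2φ) / (2r²) = 0`: it is twice continuously differentiable up to the
boundary of `[0, T] × [0, ∞)`, which is expressed by `φ` being (the restriction to this set of) a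
`C²` function on `ℝ × ℝ`; nothing else is asked of the values of `φ` outside `[0, T] × [0, ∞)`. -/
structure IsClassicalWaveMap (n : ℤ) (T : ℝ) (φ : ℝ → ℝ → ℝ) : Prop where
  contDiff : ContDiff ℝ 2 (fun p : ℝ × ℝ => φ p.1 p.2)
  mem : ∀ t ∈ Icc 0 T, MemEnergyClass n (φ t) (timeDeriv φ t)
  equation : ∀ t ∈ Icc 0 T, ∀ r : ℝ, 0 < r →
    iteratedDeriv 2 (fun s => φ s r) t - iteratedDeriv 2 (φ t) r - 1 / r * deriv (φ t) r
      + Real.sin (2 * φ t r) / (2 * r ^ 2) = 0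

/-- `(ψ(t), ψt(t))`, `t ≥ 0`, is a global (forward in time) wave map in the energy class
`𝓗 = ⋃ n, 𝓗_n`, that is, a trajectory in `[0, ∞)` of the continuous extension to `𝓗_n` of the
flow of classical solutions: on every interval `[0, T]` it is the limit, uniformly in time in the
`H × L²` distance, of classical solutions. Every classical solution on `[0, ∞)` is one (take
constant sequences). The second component `ψt` is the time derivative of `ψ`. -/
def IsGlobalWaveMap (ψ ψt : ℝ → ℝ → ℝ) : Prop :=
  ∃ n : ℤ,
    (∀ t : ℝ, 0 ≤ t → MemEnergyClass n (ψ t) (ψt t)) ∧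
    ∀ T : ℝ, 0 < T → ∃ φ : ℕ → ℝ → ℝ → ℝ,
      (∀ k, IsClassicalWaveMap n T (φ k)) ∧
      Tendsto (fun k => ⨆ t ∈ Icc 0 T,
        normHL2Sq (fun r => ψ t r - φ k t r) (fun r => ψt t r - timeDeriv (φ k) t r))
        atTop (𝓝 0)

/-- The kinetic energy `∫₀^ρ ψ_t² r dr` in the ball of radius `ρ` at time `t`. -/
noncomputable def kineticEnergy (ψt : ℝ → ℝ → ℝ) (t ρ : ℝ) : ℝ≥0∞ :=
  ∫⁻ r in Ioo 0 ρ, ENNReal.ofReal (ψt t r ^ 2 * r)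

/-!
The first assertion rests on the virial identity
`∂_t (r² ψ_t ψ_r) = ∂_r (½ r² (ψ_t² + ψ_r²) - ½ sin² ψ) - r ψ_t²`. Integrated over the region
bounded by the outgoing cone `r = t - A` and, after its tip at time `T`, by the incoming cone with
that tip, it bounds `∫_A^T ∫_0^{t-A} ψ_t² r dr dt` by the integrals of `r / 2` times the energy flux
through the two cones (`IsClassicalWaveMap.integral_localKinetic_le`).

* The energy in the outgoing cone is nondecreasing in time and bounded, so that its flux through
  late times is small. The outgoing cone thus contributes `o(T)`.
* On the incoming cone the part with `r ≤ θ T` contributes `O(θ T)`. The rest lies in the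
  self-similar region `r ≥ θ T`, where the flux has to be shown small. In the characteristic
  coordinates `u = t + r`, `v = t - r` the fluxes `a` and `b` through outgoing and incoming rays
  satisfy `∂_v a = -∂_u b` and `|∂_v a| ≤ C √(a b) / r`. A current with exponential weights then
  bounds the flux `∫ b dv` at `u` by that at any `u' > u` and by the flux through the cone
  `r = t - A` (`characteristic_rectangle_estimate`, `IsClassicalWaveMap.incoming_flux_le`). As
  `u' → ∞` the former tends to the difference `ℓ(A) - ℓ(V)` of the limits of the energies in the
  cones `r < t - A` and `r < t - V`. The function `ℓ` is nonincreasing and nonnegative, so this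
  difference is small for large `A`.

All these bounds involve only energies in balls at fixed times. They are therefore stable under
uniform convergence in `H × L²` and pass from classical solutions to trajectories in the energy
class (`IsGlobalWaveMap.lintegral_kineticEnergy_le_energies`), for which
`IsGlobalWaveMap.exists_lintegral_kineticEnergy_le` is the result.

The second assertion follows from the first by a maximal function argument,
`exists_forward_averages_le`, since `A(τ)` exceeds any given constant for large `τ`.
-/

/-! ### Partial derivatives of functions of time and radius -/

/-- The radial derivative `φ_r(t, r)`. -/
noncomputable def radDeriv (φ : ℝ → ℝ → ℝ) (t r : ℝ) : ℝ :=
  deriv (φ t) r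

section PartialDerivatives

variable {φ : ℝ → ℝ → ℝ}

lemma timeDeriv_eq_fderiv (h : ContDiff ℝ 1 (fun p : ℝ × ℝ => φ p.1 p.2)) (t r : ℝ) :
    timeDeriv φ t r = fderiv ℝ (fun p : ℝ × ℝ => φ p.1 p.2) (t, r) (1, 0) := by
  have h1 := ((h.differentiable one_ne_zero) (t, r)).hasFDerivAt
  have h2 : HasDerivAt (fun s : ℝ => (s, r)) ((1 : ℝ), (0 : ℝ)) t :=
    (hasDerivAt_id t).prodMk (hasDerivAt_const t r)
  exact (h1.comp_hasDerivAt t h2).deriv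

lemma radDeriv_eq_fderiv (h : ContDiff ℝ 1 (fun p : ℝ × ℝ => φ p.1 p.2)) (t r : ℝ) :
    radDeriv φ t r = fderiv ℝ (fun p : ℝ × ℝ => φ p.1 p.2) (t, r) (0, 1) := by
  have h1 := ((h.differentiable one_ne_zero) (t, r)).hasFDerivAt
  have h2 : HasDerivAt (fun s : ℝ => (t, s)) ((0 : ℝ), (1 : ℝ)) r :=
    (hasDerivAt_const r t).prodMk (hasDerivAt_id r)
  exact (h1.comp_hasDerivAt r h2).deriv

lemma contDiff_timeDeriv {n : ℕ} (h : ContDiff ℝ (n + 1) (fun p : ℝ × ℝ => φ p.1 p.2)) :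
    ContDiff ℝ n (fun p : ℝ × ℝ => timeDeriv φ p.1 p.2) := by
  have h1 : ContDiff ℝ 1 (fun p : ℝ × ℝ => φ p.1 p.2) := h.of_le (by simp)
  simp_rw [timeDeriv_eq_fderiv h1]
  exact (h.fderiv_right le_rfl).clm_apply contDiff_const

lemma contDiff_radDeriv {n : ℕ} (h : ContDiff ℝ (n + 1) (fun p : ℝ × ℝ => φ p.1 p.2)) :
    ContDiff ℝ n (fun p : ℝ × ℝ => radDeriv φ p.1 p.2) := by
  have h1 : ContDiff ℝ 1 (fun p : ℝ × ℝ => φ p.1 p.2) := h.of_le (by simp)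
  simp_rw [radDeriv_eq_fderiv h1]
  exact (h.fderiv_right le_rfl).clm_apply contDiff_const

lemma hasDerivAt_along_curve (h : ContDiff ℝ 1 (fun p : ℝ × ℝ => φ p.1 p.2))
    {α β : ℝ → ℝ} {α' β' s : ℝ} (hα : HasDerivAt α α' s) (hβ : HasDerivAt β β' s) :
    HasDerivAt (fun s => φ (α s) (β s))
      (α' * timeDeriv φ (α s) (β s) + β' * radDeriv φ (α s) (β s)) s := by
  have h1 := ((h.differentiable one_ne_zero) (α s, β s)).hasFDerivAt
  have h2 := h1.comp_hasDerivAt s (hα.prodMk hβ)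
  refine h2.congr_deriv ?_
  rw [timeDeriv_eq_fderiv h, radDeriv_eq_fderiv h]
  have : ((α', β') : ℝ × ℝ) = α' • (1, 0) + β' • (0, 1) := by simp
  rw [this, map_add, map_smul, map_smul, smul_eq_mul, smul_eq_mul]

lemma timeDeriv_radDeriv_comm (h : ContDiff ℝ 2 (fun p : ℝ × ℝ => φ p.1 p.2)) (t r : ℝ) :
    timeDeriv (radDeriv φ) t r = radDeriv (timeDeriv φ) t r := by
  have h1 : ContDiff ℝ 1 (fun p : ℝ × ℝ => φ p.1 p.2) := h.of_le (by norm_num)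
  have h2 : ContDiff ℝ ((1 : ℕ) + 1) (fun p : ℝ × ℝ => φ p.1 p.2) := by norm_num; exact h
  have hd : DifferentiableAt ℝ (fderiv ℝ (fun p : ℝ × ℝ => φ p.1 p.2)) (t, r) :=
    ((h.fderiv_right (m := 1) (by norm_num)).differentiable one_ne_zero) _
  have hsymm : IsSymmSndFDerivAt ℝ (fun p : ℝ × ℝ => φ p.1 p.2) (t, r) :=
    h.contDiffAt.isSymmSndFDerivAt (by simp)
  rw [timeDeriv_eq_fderiv (contDiff_radDeriv h2), radDeriv_eq_fderiv (contDiff_timeDeriv h2)]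
  simp_rw [radDeriv_eq_fderiv h1, timeDeriv_eq_fderiv h1]
  have e1 : ∀ w : ℝ × ℝ, fderiv ℝ (fun p : ℝ × ℝ =>
      fderiv ℝ (fun p : ℝ × ℝ => φ p.1 p.2) (p.1, p.2) w) (t, r)
      = (fderiv ℝ (fderiv ℝ (fun p : ℝ × ℝ => φ p.1 p.2)) (t, r)).flip w := by
    intro w
    have := hd.hasFDerivAt.clm_apply (hasFDerivAt_const w (t, r))
    refine HasFDerivAt.fderiv (this.congr_fderiv ?_)
    ext <;> simp
  rw [e1, e1]
  simpa using hsymm (1, 0) (0, 1)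

end PartialDerivatives

/-! ### Integrals over balls of moving radius -/

/-- If `∂_t p = ∂_r q` in integrated form, `∫₀^r ∂_t p = q`, then `(t, r) ↦ ∫₀^r p(t, s) ds` is a
potential of the pair `(q, p)`, so that its derivative along any curve `r = ρ(t)` is
`q + ρ' p`. The densities need not be defined continuously at `r = 0`. -/
theorem hasDerivAt_integral_of_balanceLaw {p pt q : ℝ → ℝ → ℝ} {I : Set ℝ} (hI : IsOpen I)
    (hp : ContinuousOn (fun z : ℝ × ℝ => p z.1 z.2) (I ×ˢ Ioi 0))
    (hpt : ∀ t ∈ I, ContinuousOn (pt t) (Ioi 0))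
    (hq : ContinuousOn (fun z : ℝ × ℝ => q z.1 z.2) (I ×ˢ Ioi 0))
    (hbd : ∀ t ∈ I, ∀ R, ∃ C, ∀ᶠ t' in 𝓝 t, ∀ s ∈ Ioc 0 R, |p t' s| ≤ C ∧ |pt t' s| ≤ C)
    (hd : ∀ t ∈ I, ∀ s, 0 < s → HasDerivAt (fun t => p t s) (pt t s) t)
    (hint : ∀ t ∈ I, ∀ r, 0 < r → ∫ s in 0..r, pt t s = q t r)
    {ρ : ℝ → ℝ} {ρ' t : ℝ} (ht : t ∈ I) (hρ0 : 0 < ρ t) (hρ : HasDerivAt ρ ρ' t) :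
    HasDerivAt (fun t => ∫ s in 0..ρ t, p t s) (q t (ρ t) + ρ' * p t (ρ t)) t := by
  have hps : ∀ t ∈ I, ContinuousOn (p t) (Ioi 0) := fun t ht =>
    ContinuousOn.comp (f := fun s : ℝ => (t, s)) hp (by fun_prop) (fun s hs => ⟨ht, hs⟩)
  have hmeas : ∀ {g : ℝ → ℝ} {R : ℝ}, 0 ≤ R → ContinuousOn g (Ioi 0) →
      AEStronglyMeasurable g (volume.restrict (uIoc 0 R)) := by
    intro g R hR hg
    rw [uIoc_of_le hR]
    exact (hg.mono Ioc_subset_Ioi_self).aestronglyMeasurable measurableSet_Ioc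
  have hii : ∀ t ∈ I, ∀ R, 0 ≤ R → IntervalIntegrable (p t) volume 0 R := by
    intro t ht R hR
    obtain ⟨C, hC⟩ := hbd t ht R
    refine (intervalIntegrable_const (c := C)).mono_fun (hmeas hR (hps t ht)) ?_
    rw [uIoc_of_le hR]
    filter_upwards [ae_restrict_mem measurableSet_Ioc] with s hs
    exact ((hC.self_of_nhds s hs).1).trans (le_abs_self C)
  have hopen : IsOpen (I ×ˢ Ioi (0 : ℝ)) := hI.prod isOpen_Ioi
  have hmem : ((t, ρ t) : ℝ × ℝ) ∈ I ×ˢ Ioi (0 : ℝ) := ⟨ht, hρ0⟩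
  have key := hasStrictFDerivAt_uncurry_coprod (𝕜 := ℝ) (u := (t, ρ t))
    (f := fun t r => ∫ s in 0..r, p t s)
    (f₁ := fun t r => ContinuousLinearMap.toSpanSingleton ℝ (q t r))
    (f₂ := fun t r => ContinuousLinearMap.toSpanSingleton ℝ (p t r)) ?_ ?_ ?_ ?_
  · have := key.hasFDerivAt.comp_hasDerivAt t ((hasDerivAt_id t).prodMk hρ)
    refine HasDerivAt.congr_deriv this ?_
    simp [Function.HasUncurry.uncurry]
  · filter_upwards [hopen.mem_nhds hmem] with v hv
    rw [mem_prod] at hv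
    have hv2 : 0 < v.2 := hv.2
    obtain ⟨C, hC⟩ := hbd v.1 hv.1 v.2
    have hC' := hC.and (hI.mem_nhds hv.1)
    have := intervalIntegral.hasDerivAt_integral_of_dominated_loc_of_deriv_le (μ := volume)
      (F := p) (F' := pt) (a := 0) (b := v.2) (x₀ := v.1) (bound := fun _ => C) hC'
      (by filter_upwards [hI.mem_nhds hv.1] with t ht; exact hmeas hv2.le (hps t ht))
      (hii v.1 hv.1 v.2 hv2.le) (hmeas hv2.le (hpt v.1 hv.1))
      (by
        refine ae_of_all _ fun s hs t ht => ?_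
        rw [uIoc_of_le hv2.le] at hs
        exact (ht.1 s hs).2)
      intervalIntegrable_const
      (by
        refine ae_of_all _ fun s hs t ht => ?_
        rw [uIoc_of_le hv2.le] at hs
        exact hd t ht.2 s hs.1)
    have h2 := this.2
    rw [hint v.1 hv.1 v.2 hv2] at h2
    exact h2.hasFDerivAt
  · filter_upwards [hopen.mem_nhds hmem] with v hv
    rw [mem_prod] at hv
    have hv2 : 0 < v.2 := hv.2
    have hc : ContinuousAt (p v.1) v.2 := (hps v.1 hv.1).continuousAt (Ioi_mem_nhds hv2)
    exact (intervalIntegral.integral_hasDerivAt_right (hii v.1 hv.1 v.2 hv2.le)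
      ((hps v.1 hv.1).stronglyMeasurableAtFilter isOpen_Ioi _ hv2) hc).hasFDerivAt
  · have : ContinuousAt (fun z : ℝ × ℝ => q z.1 z.2) (t, ρ t) :=
      hq.continuousAt (hopen.mem_nhds hmem)
    exact ((ContinuousLinearMap.toSpanSingletonCLE (𝕜 := ℝ) (E := ℝ)).continuous.continuousAt).comp
      this
  · have : ContinuousAt (fun z : ℝ × ℝ => p z.1 z.2) (t, ρ t) :=
      hp.continuousAt (hopen.mem_nhds hmem)
    exact ((ContinuousLinearMap.toSpanSingletonCLE (𝕜 := ℝ) (E := ℝ)).continuous.continuousAt).comp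
      this

/-! ### Local energy and virial identities for classical solutions -/

/-- Twice the energy density of `φ`, with respect to `dr`:
`r (φ_t² + φ_r²) + sin²(φ) / r`. Its value at `r = 0` is `0`. -/
noncomputable def energyDensity (φ : ℝ → ℝ → ℝ) (t r : ℝ) : ℝ :=
  r * (timeDeriv φ t r ^ 2 + radDeriv φ t r ^ 2) + Real.sin (φ t r) ^ 2 / r

/-- The flux `2 r φ_t φ_r` of the energy density. -/
noncomputable def energyFlux (φ : ℝ → ℝ → ℝ) (t r : ℝ) : ℝ :=
  2 * r * timeDeriv φ t r * radDeriv φ t r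

/-- The energy in the ball of radius `ρ` at time `t`, normalised as in `waveEnergy`. -/
noncomputable def localEnergy (φ : ℝ → ℝ → ℝ) (t ρ : ℝ) : ℝ :=
  ∫ s in 0..ρ, energyDensity φ t s

/-- The kinetic energy in the ball of radius `ρ` at time `t`. -/
noncomputable def localKinetic (φ : ℝ → ℝ → ℝ) (t ρ : ℝ) : ℝ :=
  ∫ s in 0..ρ, s * timeDeriv φ t s ^ 2

/-- The virial `∫₀^ρ r² φ_t φ_r dr`, the momentum along the vector field `r ∂_r`. -/
noncomputable def localVirial (φ : ℝ → ℝ → ℝ) (t ρ : ℝ) : ℝ :=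
  ∫ s in 0..ρ, s ^ 2 * timeDeriv φ t s * radDeriv φ t s

/-- The energy flux density `r (φ_t + φ_r)² + sin²(φ) / r` through outgoing light rays. -/
noncomputable def outFlux (φ : ℝ → ℝ → ℝ) (t r : ℝ) : ℝ :=
  r * (timeDeriv φ t r + radDeriv φ t r) ^ 2 + Real.sin (φ t r) ^ 2 / r

/-- The energy flux density `r (φ_t - φ_r)² + sin²(φ) / r` through incoming light rays. -/
noncomputable def inFlux (φ : ℝ → ℝ → ℝ) (t r : ℝ) : ℝ :=
  r * (timeDeriv φ t r - radDeriv φ t r) ^ 2 + Real.sin (φ t r) ^ 2 / r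

lemma outFlux_nonneg (φ : ℝ → ℝ → ℝ) {t r : ℝ} (hr : 0 ≤ r) : 0 ≤ outFlux φ t r := by
  unfold outFlux; positivity

lemma inFlux_nonneg (φ : ℝ → ℝ → ℝ) {t r : ℝ} (hr : 0 ≤ r) : 0 ≤ inFlux φ t r := by
  unfold inFlux; positivity

lemma energyDensity_nonneg (φ : ℝ → ℝ → ℝ) {t r : ℝ} (hr : 0 ≤ r) : 0 ≤ energyDensity φ t r := by
  unfold energyDensity; positivity

lemma localEnergy_nonneg (φ : ℝ → ℝ → ℝ) (t : ℝ) {ρ : ℝ} (hρ : 0 ≤ ρ) : 0 ≤ localEnergy φ t ρ :=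
  intervalIntegral.integral_nonneg hρ fun _ hs => energyDensity_nonneg φ hs.1

lemma localKinetic_nonneg (φ : ℝ → ℝ → ℝ) (t : ℝ) {ρ : ℝ} (hρ : 0 ≤ ρ) :
    0 ≤ localKinetic φ t ρ :=
  intervalIntegral.integral_nonneg hρ fun _ hs => mul_nonneg hs.1 (sq_nonneg _)

namespace IsClassicalWaveMap

variable {n : ℤ} {T : ℝ} {φ : ℝ → ℝ → ℝ}

lemma contDiff_one (h : IsClassicalWaveMap n T φ) :
    ContDiff ℝ 1 (fun p : ℝ × ℝ => φ p.1 p.2) := h.contDiff.of_le (by norm_num)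

lemma contDiff_two (h : IsClassicalWaveMap n T φ) :
    ContDiff ℝ ((1 : ℕ) + 1) (fun p : ℝ × ℝ => φ p.1 p.2) := by
  norm_num; exact h.contDiff

lemma contDiff_timeDeriv (h : IsClassicalWaveMap n T φ) :
    ContDiff ℝ 1 (fun p : ℝ × ℝ => timeDeriv φ p.1 p.2) := _root_.contDiff_timeDeriv h.contDiff_two

lemma contDiff_radDeriv (h : IsClassicalWaveMap n T φ) :
    ContDiff ℝ 1 (fun p : ℝ × ℝ => radDeriv φ p.1 p.2) := _root_.contDiff_radDeriv h.contDiff_two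

lemma continuous (h : IsClassicalWaveMap n T φ) :
    Continuous (fun p : ℝ × ℝ => φ p.1 p.2) := h.contDiff.continuous

lemma continuous_timeDeriv (h : IsClassicalWaveMap n T φ) :
    Continuous (fun p : ℝ × ℝ => timeDeriv φ p.1 p.2) := h.contDiff_timeDeriv.continuous

lemma continuous_radDeriv (h : IsClassicalWaveMap n T φ) :
    Continuous (fun p : ℝ × ℝ => radDeriv φ p.1 p.2) := h.contDiff_radDeriv.continuous

lemma continuous_timeDeriv_timeDeriv (h : IsClassicalWaveMap n T φ) :
    Continuous (fun p : ℝ × ℝ => timeDeriv (timeDeriv φ) p.1 p.2) :=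
  (_root_.contDiff_timeDeriv (n := 0) (by simpa using h.contDiff_timeDeriv)).continuous

lemma continuous_radDeriv_timeDeriv (h : IsClassicalWaveMap n T φ) :
    Continuous (fun p : ℝ × ℝ => radDeriv (timeDeriv φ) p.1 p.2) :=
  (_root_.contDiff_radDeriv (n := 0) (by simpa using h.contDiff_timeDeriv)).continuous

lemma wave_eq (h : IsClassicalWaveMap n T φ) {t r : ℝ} (ht : t ∈ Icc 0 T) (hr : 0 < r) :
    timeDeriv (timeDeriv φ) t r = radDeriv (radDeriv φ) t r + radDeriv φ t r / r
      - Real.sin (φ t r) * Real.cos (φ t r) / r ^ 2 := by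
  have := h.equation t ht r hr
  simp only [iteratedDeriv_succ, iteratedDeriv_zero, Real.sin_two_mul] at this
  have e1 : deriv (deriv fun s => φ s r) t = timeDeriv (timeDeriv φ) t r := rfl
  have e2 : deriv (deriv (φ t)) r = radDeriv (radDeriv φ) t r := rfl
  have e3 : deriv (φ t) r = radDeriv φ t r := rfl
  rw [e1, e2, e3] at this
  field_simp at this ⊢
  linarith

lemma apply_zero (h : IsClassicalWaveMap n T φ) {t : ℝ} (ht : t ∈ Icc 0 T) : φ t 0 = 0 := by
  have h1 : Tendsto (φ t) (𝓝[>] 0) (𝓝 (φ t 0)) := by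
    have := h.continuous
    have : Continuous (φ t) := this.comp (Continuous.prodMk_right t)
    exact this.continuousAt.tendsto.mono_left nhdsWithin_le_nhds
  exact tendsto_nhds_unique h1 (h.mem t ht).tendsto_zero

/-- Since `φ` vanishes on the axis, `sin φ = O(r)` locally uniformly: the singular terms of the
densities are bounded. -/
lemma exists_bound (h : IsClassicalWaveMap n T φ) {t : ℝ} (ht : t ∈ Ioo 0 T) (R : ℝ) :
    ∃ M, 0 ≤ M ∧ ∀ᶠ t' in 𝓝 t, ∀ s ∈ Icc 0 R, |timeDeriv φ t' s| ≤ M ∧ |radDeriv φ t' s| ≤ M ∧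
      |timeDeriv (timeDeriv φ) t' s| ≤ M ∧ |radDeriv (timeDeriv φ) t' s| ≤ M ∧
      |Real.sin (φ t' s)| ≤ M * s := by
  have hK : IsCompact (Icc 0 T ×ˢ Icc 0 R) := isCompact_Icc.prod isCompact_Icc
  obtain ⟨C1, h1⟩ := hK.exists_bound_of_continuousOn h.continuous_timeDeriv.continuousOn
  obtain ⟨C2, h2⟩ := hK.exists_bound_of_continuousOn h.continuous_radDeriv.continuousOn
  obtain ⟨C3, h3⟩ := hK.exists_bound_of_continuousOn h.continuous_timeDeriv_timeDeriv.continuousOn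
  obtain ⟨C4, h4⟩ := hK.exists_bound_of_continuousOn h.continuous_radDeriv_timeDeriv.continuousOn
  refine ⟨max (max (max C1 C2) (max C3 C4)) 0, le_max_right _ _, ?_⟩
  filter_upwards [Ioo_mem_nhds ht.1 ht.2] with t' ht' s hs
  have htc : t' ∈ Icc 0 T := Ioo_subset_Icc_self ht'
  have hm : ((t', s) : ℝ × ℝ) ∈ Icc 0 T ×ˢ Icc 0 R := ⟨htc, hs⟩
  have hy : ∀ s' ∈ Icc 0 R, |radDeriv φ t' s'| ≤ max (max (max C1 C2) (max C3 C4)) 0 :=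
    fun s' hs' => (h2 (t', s') ⟨htc, hs'⟩).trans (by simp)
  refine ⟨(h1 _ hm).trans (by simp), hy s hs, (h3 _ hm).trans (by simp),
    (h4 _ hm).trans (by simp), ?_⟩
  have hdiff : ∀ s' ∈ Icc 0 R, HasDerivWithinAt (φ t') (radDeriv φ t' s') (Icc 0 R) s' := by
    intro s' _
    have := hasDerivAt_along_curve h.contDiff_one (hasDerivAt_const s' t') (hasDerivAt_id s')
    simpa using this.hasDerivWithinAt
  have hmv := (convex_Icc 0 R).norm_image_sub_le_of_norm_hasDerivWithin_le hdiff hy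
    (left_mem_Icc.2 (hs.1.trans hs.2)) hs
  rw [h.apply_zero htc, sub_zero, sub_zero, Real.norm_eq_abs, Real.norm_eq_abs,
    abs_of_nonneg hs.1] at hmv
  exact (Real.abs_sin_le_abs).trans hmv

lemma hasDerivAt_time (h : IsClassicalWaveMap n T φ) (t r : ℝ) :
    HasDerivAt (fun t => φ t r) (timeDeriv φ t r) t := by
  simpa using hasDerivAt_along_curve h.contDiff_one (hasDerivAt_id t) (hasDerivAt_const t r)

lemma hasDerivAt_rad (h : IsClassicalWaveMap n T φ) (t r : ℝ) :
    HasDerivAt (φ t) (radDeriv φ t r) r := by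
  simpa using hasDerivAt_along_curve h.contDiff_one (hasDerivAt_const r t) (hasDerivAt_id r)

lemma hasDerivAt_timeDeriv_time (h : IsClassicalWaveMap n T φ) (t r : ℝ) :
    HasDerivAt (fun t => timeDeriv φ t r) (timeDeriv (timeDeriv φ) t r) t := by
  simpa using hasDerivAt_along_curve h.contDiff_timeDeriv (hasDerivAt_id t) (hasDerivAt_const t r)

lemma hasDerivAt_timeDeriv_rad (h : IsClassicalWaveMap n T φ) (t r : ℝ) :
    HasDerivAt (timeDeriv φ t) (radDeriv (timeDeriv φ) t r) r := by
  simpa using hasDerivAt_along_curve h.contDiff_timeDeriv (hasDerivAt_const r t) (hasDerivAt_id r)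

lemma hasDerivAt_radDeriv_time (h : IsClassicalWaveMap n T φ) (t r : ℝ) :
    HasDerivAt (fun t => radDeriv φ t r) (radDeriv (timeDeriv φ) t r) t := by
  rw [← timeDeriv_radDeriv_comm h.contDiff]
  simpa using hasDerivAt_along_curve h.contDiff_radDeriv (hasDerivAt_id t) (hasDerivAt_const t r)

lemma hasDerivAt_radDeriv_rad (h : IsClassicalWaveMap n T φ) (t r : ℝ) :
    HasDerivAt (radDeriv φ t) (radDeriv (radDeriv φ) t r) r := by
  simpa using hasDerivAt_along_curve h.contDiff_radDeriv (hasDerivAt_const r t) (hasDerivAt_id r)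

lemma continuousOn_energyDensity (h : IsClassicalWaveMap n T φ) :
    ContinuousOn (fun z : ℝ × ℝ => energyDensity φ z.1 z.2) (univ ×ˢ Ioi 0) := by
  have h0 := h.continuous
  have h1 := h.continuous_timeDeriv
  have h2 := h.continuous_radDeriv
  unfold energyDensity
  refine ContinuousOn.add (by fun_prop) (ContinuousOn.div (by fun_prop) (by fun_prop) ?_)
  intro z hz
  exact ne_of_gt hz.2

lemma continuousOn_energyDensity_slice (h : IsClassicalWaveMap n T φ) (t : ℝ) :
    ContinuousOn (energyDensity φ t) (Ioi 0) :=
  ContinuousOn.comp (f := fun s : ℝ => (t, s)) h.continuousOn_energyDensity (by fun_prop)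
    (fun _ hs => ⟨mem_univ _, hs⟩)

lemma exists_energyDensity_bound (h : IsClassicalWaveMap n T φ) {t : ℝ} (ht : t ∈ Ioo 0 T)
    (R : ℝ) : ∃ C, ∀ᶠ t' in 𝓝 t, ∀ s ∈ Ioc 0 R, |energyDensity φ t' s| ≤ C := by
  obtain ⟨M, hM, hb⟩ := h.exists_bound ht R
  refine ⟨R * (M ^ 2 + M ^ 2) + M ^ 2 * R, ?_⟩
  filter_upwards [hb] with t' hb s hs
  obtain ⟨b1, b2, -, -, b5⟩ := hb s (Ioc_subset_Icc_self hs)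
  have hs0 := hs.1
  rw [abs_of_nonneg (energyDensity_nonneg φ hs0.le)]
  unfold energyDensity
  have e1 : timeDeriv φ t' s ^ 2 ≤ M ^ 2 := sq_le_sq' (abs_le.1 b1).1 (abs_le.1 b1).2
  have e2 : radDeriv φ t' s ^ 2 ≤ M ^ 2 := sq_le_sq' (abs_le.1 b2).1 (abs_le.1 b2).2
  have e3 : Real.sin (φ t' s) ^ 2 ≤ (M * s) ^ 2 := sq_le_sq' (abs_le.1 b5).1 (abs_le.1 b5).2
  have e4 : Real.sin (φ t' s) ^ 2 / s ≤ M ^ 2 * R := by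
    rw [div_le_iff₀ hs0]
    nlinarith [mul_le_mul_of_nonneg_left hs.2 (mul_nonneg (sq_nonneg M) hs0.le)]
  have e5 : s * (timeDeriv φ t' s ^ 2 + radDeriv φ t' s ^ 2) ≤ R * (M ^ 2 + M ^ 2) :=
    mul_le_mul hs.2 (add_le_add e1 e2) (by positivity) (hs0.le.trans hs.2)
  linarith

lemma intervalIntegrable_energyDensity (h : IsClassicalWaveMap n T φ) {t : ℝ} (ht : t ∈ Ioo 0 T)
    {R : ℝ} (hR : 0 ≤ R) : IntervalIntegrable (energyDensity φ t) volume 0 R := by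
  obtain ⟨C, hC⟩ := h.exists_energyDensity_bound ht R
  refine (intervalIntegrable_const (c := C)).mono_fun ?_ ?_
  · rw [uIoc_of_le hR]
    exact ((h.continuousOn_energyDensity_slice t).mono Ioc_subset_Ioi_self).aestronglyMeasurable
      measurableSet_Ioc
  · rw [uIoc_of_le hR]
    filter_upwards [ae_restrict_mem measurableSet_Ioc] with s hs
    exact (hC.self_of_nhds s hs).trans (le_abs_self C)

/-- The local form `∂_t e = ∂_r (2 r φ_t φ_r)` of the conservation of energy, integrated over a
ball of moving radius. -/
theorem hasDerivAt_localEnergy (h : IsClassicalWaveMap n T φ) {ρ : ℝ → ℝ} {ρ' t : ℝ}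
    (ht : t ∈ Ioo 0 T) (hρ0 : 0 < ρ t) (hρ : HasDerivAt ρ ρ' t) :
    HasDerivAt (fun t => localEnergy φ t (ρ t))
      (energyFlux φ t (ρ t) + ρ' * energyDensity φ t (ρ t)) t := by
  have c0 := h.continuous
  have c1 := h.continuous_timeDeriv
  have c2 := h.continuous_radDeriv
  have c3 := h.continuous_timeDeriv_timeDeriv
  have c4 := h.continuous_radDeriv_timeDeriv
  have sl : ∀ {f : ℝ → ℝ → ℝ}, Continuous (fun p : ℝ × ℝ => f p.1 p.2) → ∀ t, Continuous (f t) :=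
    fun hf t => hf.comp (Continuous.prodMk_right t)
  set pt : ℝ → ℝ → ℝ := fun t s =>
    2 * s * (timeDeriv φ t s * timeDeriv (timeDeriv φ) t s
      + radDeriv φ t s * radDeriv (timeDeriv φ) t s)
    + 2 * Real.sin (φ t s) * Real.cos (φ t s) * timeDeriv φ t s / s with hptdef
  have hptc : ∀ t, ContinuousOn (pt t) (Ioi 0) := by
    intro t
    have d0 := sl c0 t
    have d1 := sl c1 t
    have d2 := sl c2 t
    have d3 := sl c3 t
    have d4 := sl c4 t
    refine ContinuousOn.add (by fun_prop) (ContinuousOn.div (by fun_prop) (by fun_prop) ?_)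
    intro z hz
    exact ne_of_gt hz
  have hptb : ∀ t ∈ Ioo 0 T, ∀ R, ∃ C, ∀ᶠ t' in 𝓝 t, ∀ s ∈ Ioc 0 R, |pt t' s| ≤ C := by
    intro t ht R
    obtain ⟨M, hM, hb⟩ := h.exists_bound ht R
    refine ⟨2 * R * (M * M + M * M) + 2 * M * M, ?_⟩
    filter_upwards [hb] with t' hb s hs
    obtain ⟨b1, b2, b3, b4, b5⟩ := hb s (Ioc_subset_Icc_self hs)
    have hs0 := hs.1
    have hR0 : 0 ≤ R := hs0.le.trans hs.2
    have e1 : |2 * s * (timeDeriv φ t' s * timeDeriv (timeDeriv φ) t' s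
        + radDeriv φ t' s * radDeriv (timeDeriv φ) t' s)| ≤ 2 * R * (M * M + M * M) := by
      rw [abs_mul, abs_of_pos (by positivity : 0 < 2 * s)]
      refine mul_le_mul (by linarith [hs.2]) ((abs_add_le _ _).trans (add_le_add ?_ ?_))
        (abs_nonneg _) (by positivity)
      · rw [abs_mul]; exact mul_le_mul b1 b3 (abs_nonneg _) hM
      · rw [abs_mul]; exact mul_le_mul b2 b4 (abs_nonneg _) hM
    have e2 : |2 * Real.sin (φ t' s) * Real.cos (φ t' s) * timeDeriv φ t' s / s| ≤ 2 * M * M := by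
      rw [abs_div, abs_of_pos hs0, div_le_iff₀ hs0, abs_mul, abs_mul, abs_mul, abs_two]
      have := mul_le_mul (mul_le_mul b5 (Real.abs_cos_le_one (φ t' s)) (abs_nonneg _)
        (by positivity)) b1 (abs_nonneg _) (by positivity)
      nlinarith
    exact (abs_add_le _ _).trans (add_le_add e1 e2)
  refine hasDerivAt_integral_of_balanceLaw (p := energyDensity φ) (pt := pt) (q := energyFlux φ)
    isOpen_Ioo (h.continuousOn_energyDensity.mono (prod_mono_left (subset_univ _)))
    (fun t _ => hptc t) ?_ ?_ ?_ ?_ ht hρ0 hρ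
  · unfold energyFlux; fun_prop
  · intro t ht R
    obtain ⟨C1, h1⟩ := h.exists_energyDensity_bound ht R
    obtain ⟨C2, h2⟩ := hptb t ht R
    refine ⟨max C1 C2, ?_⟩
    filter_upwards [h1, h2] with t' h1 h2 s hs
    exact ⟨(h1 s hs).trans (le_max_left _ _), (h2 s hs).trans (le_max_right _ _)⟩
  · intro t _ s hs
    have h1 := h.hasDerivAt_time t s
    have h2 := h.hasDerivAt_timeDeriv_time t s
    have h3 := h.hasDerivAt_radDeriv_time t s
    have := (((h2.fun_pow 2).fun_add (h3.fun_pow 2)).const_mul s).fun_add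
      ((h1.sin.fun_pow 2).div_const s)
    refine HasDerivAt.congr_deriv this ?_
    simp only [hptdef]
    push_cast
    ring
  · intro t ht r hr
    have hF : ContinuousOn (energyFlux φ t) (Icc 0 r) := by
      have d1 := sl c1 t
      have d2 := sl c2 t
      unfold energyFlux
      fun_prop
    have hD : ∀ s ∈ Ioo 0 r, HasDerivAt (energyFlux φ t) (pt t s) s := by
      intro s hs
      have hs0 := hs.1
      have := (((hasDerivAt_id s).const_mul 2).fun_mul (h.hasDerivAt_timeDeriv_rad t s)).fun_mul
        (h.hasDerivAt_radDeriv_rad t s)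
      refine HasDerivAt.congr_deriv this ?_
      simp only [hptdef, h.wave_eq (Ioo_subset_Icc_self ht) hs0, id]
      field_simp
      ring
    obtain ⟨C, hC⟩ := hptb t ht r
    have hI : IntervalIntegrable (pt t) volume 0 r := by
      refine (intervalIntegrable_const (c := C)).mono_fun ?_ ?_
      · rw [uIoc_of_le hr.le]
        exact ((hptc t).mono Ioc_subset_Ioi_self).aestronglyMeasurable measurableSet_Ioc
      · rw [uIoc_of_le hr.le]
        filter_upwards [ae_restrict_mem measurableSet_Ioc] with s hs
        exact (hC.self_of_nhds s hs).trans (le_abs_self C)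
    rw [intervalIntegral.integral_eq_sub_of_hasDerivAt_of_le hr.le hF hD hI]
    simp [energyFlux]

theorem hasDerivAt_localEnergy_outgoing (h : IsClassicalWaveMap n T φ) {v t : ℝ}
    (ht : t ∈ Ioo 0 T) (hv : v < t) :
    HasDerivAt (fun t => localEnergy φ t (t - v)) (outFlux φ t (t - v)) t := by
  refine (h.hasDerivAt_localEnergy ht (by simpa) ((hasDerivAt_id t).sub_const v)).congr_deriv ?_
  simp only [energyFlux, energyDensity, outFlux, id]; ring

theorem hasDerivAt_localEnergy_incoming (h : IsClassicalWaveMap n T φ) {u t : ℝ}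
    (ht : t ∈ Ioo 0 T) (hu : t < u) :
    HasDerivAt (fun t => localEnergy φ t (u - t)) (-inFlux φ t (u - t)) t := by
  refine (h.hasDerivAt_localEnergy ht (by simpa) ((hasDerivAt_id t).const_sub u)).congr_deriv ?_
  simp only [energyFlux, energyDensity, inFlux, id]; ring

lemma continuous_localKinetic (h : IsClassicalWaveMap n T φ) :
    Continuous (fun p : ℝ × ℝ => localKinetic φ p.1 p.2) := by
  have c1 := h.continuous_timeDeriv
  unfold localKinetic
  refine intervalIntegral.continuous_parametric_intervalIntegral_of_continuous
    (f := fun (p : ℝ × ℝ) s => s * timeDeriv φ p.1 s ^ 2) (s := fun p : ℝ × ℝ => p.2)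
    ?_ continuous_snd
  have : Continuous (fun q : (ℝ × ℝ) × ℝ => timeDeriv φ q.1.1 q.2) :=
    c1.comp ((continuous_fst.comp continuous_fst).prodMk continuous_snd)
  simp only [Function.uncurry_def]
  fun_prop

lemma continuous_localVirial (h : IsClassicalWaveMap n T φ) :
    Continuous (fun p : ℝ × ℝ => localVirial φ p.1 p.2) := by
  have c1 := h.continuous_timeDeriv
  have c2 := h.continuous_radDeriv
  unfold localVirial
  refine intervalIntegral.continuous_parametric_intervalIntegral_of_continuous
    (f := fun (p : ℝ × ℝ) s => s ^ 2 * timeDeriv φ p.1 s * radDeriv φ p.1 s)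
    (s := fun p : ℝ × ℝ => p.2) ?_ continuous_snd
  have : Continuous (fun q : (ℝ × ℝ) × ℝ => timeDeriv φ q.1.1 q.2) :=
    c1.comp ((continuous_fst.comp continuous_fst).prodMk continuous_snd)
  have : Continuous (fun q : (ℝ × ℝ) × ℝ => radDeriv φ q.1.1 q.2) :=
    c2.comp ((continuous_fst.comp continuous_fst).prodMk continuous_snd)
  simp only [Function.uncurry_def]
  fun_prop

/-- The virial identity `∂_t (r² φ_t φ_r) = ∂_r (½ r² (φ_t² + φ_r²) - ½ sin² φ) - r φ_t²`,
integrated over a ball of moving radius. -/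
theorem hasDerivAt_localVirial (h : IsClassicalWaveMap n T φ) {ρ : ℝ → ℝ} {ρ' t : ℝ}
    (ht : t ∈ Ioo 0 T) (hρ0 : 0 < ρ t) (hρ : HasDerivAt ρ ρ' t) :
    HasDerivAt (fun t => localVirial φ t (ρ t))
      ((ρ t ^ 2 * (timeDeriv φ t (ρ t) ^ 2 + radDeriv φ t (ρ t) ^ 2)
          - Real.sin (φ t (ρ t)) ^ 2) / 2 - localKinetic φ t (ρ t)
        + ρ' * (ρ t ^ 2 * timeDeriv φ t (ρ t) * radDeriv φ t (ρ t))) t := by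
  have c0 := h.continuous
  have c1 := h.continuous_timeDeriv
  have c2 := h.continuous_radDeriv
  have c3 := h.continuous_timeDeriv_timeDeriv
  have c4 := h.continuous_radDeriv_timeDeriv
  have c5 := h.continuous_localKinetic
  have sl : ∀ {f : ℝ → ℝ → ℝ}, Continuous (fun p : ℝ × ℝ => f p.1 p.2) → ∀ t, Continuous (f t) :=
    fun hf t => hf.comp (Continuous.prodMk_right t)
  set p : ℝ → ℝ → ℝ := fun t s => s ^ 2 * timeDeriv φ t s * radDeriv φ t s with hpdef
  set pt : ℝ → ℝ → ℝ := fun t s => s ^ 2 * (timeDeriv (timeDeriv φ) t s * radDeriv φ t s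
    + timeDeriv φ t s * radDeriv (timeDeriv φ) t s) with hptdef
  have hpc : Continuous (fun z : ℝ × ℝ => p z.1 z.2) := by fun_prop
  have hptc : Continuous (fun z : ℝ × ℝ => pt z.1 z.2) := by fun_prop
  refine hasDerivAt_integral_of_balanceLaw (p := p) (pt := pt)
    (q := fun t r => (r ^ 2 * (timeDeriv φ t r ^ 2 + radDeriv φ t r ^ 2)
          - Real.sin (φ t r) ^ 2) / 2 - localKinetic φ t r)
    isOpen_Ioo hpc.continuousOn (fun t _ => (sl hptc t).continuousOn) ?_ ?_ ?_ ?_ ht hρ0 hρ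
  · fun_prop
  · intro t ht R
    have hK : IsCompact (Icc 0 T ×ˢ Icc 0 R) := isCompact_Icc.prod isCompact_Icc
    obtain ⟨C1, h1⟩ := hK.exists_bound_of_continuousOn hpc.continuousOn
    obtain ⟨C2, h2⟩ := hK.exists_bound_of_continuousOn hptc.continuousOn
    refine ⟨max C1 C2, ?_⟩
    filter_upwards [Ioo_mem_nhds ht.1 ht.2] with t' ht' s hs
    have hm : ((t', s) : ℝ × ℝ) ∈ Icc 0 T ×ˢ Icc 0 R :=
      ⟨Ioo_subset_Icc_self ht', Ioc_subset_Icc_self hs⟩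
    exact ⟨(h1 _ hm).trans (le_max_left _ _), (h2 _ hm).trans (le_max_right _ _)⟩
  · intro t _ s hs
    have := ((h.hasDerivAt_timeDeriv_time t s).const_mul (s ^ 2)).fun_mul
      (h.hasDerivAt_radDeriv_time t s)
    refine HasDerivAt.congr_deriv this ?_
    simp only [hptdef]
    ring
  · intro t ht r hr
    have d0 := sl c0 t
    have d1 := sl c1 t
    have d2 := sl c2 t
    have d3 := sl hptc t
    have hk : IntervalIntegrable (fun s => s * timeDeriv φ t s ^ 2) volume 0 r :=
      Continuous.intervalIntegrable (by fun_prop) _ _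
    have hD : ∀ s ∈ Ioo 0 r, HasDerivAt (fun r => (r ^ 2 * (timeDeriv φ t r ^ 2
        + radDeriv φ t r ^ 2) - Real.sin (φ t r) ^ 2) / 2) (pt t s + s * timeDeriv φ t s ^ 2) s := by
      intro s hs
      have hs0 := hs.1
      have := ((((hasDerivAt_id s).fun_pow 2).fun_mul
        (((h.hasDerivAt_timeDeriv_rad t s).fun_pow 2).fun_add
          ((h.hasDerivAt_radDeriv_rad t s).fun_pow 2))).fun_sub
        ((h.hasDerivAt_rad t s).sin.fun_pow 2)).div_const 2
      refine HasDerivAt.congr_deriv this ?_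
      simp only [hptdef, h.wave_eq (Ioo_subset_Icc_self ht) hs0, id]
      push_cast
      field_simp
      ring
    have := intervalIntegral.integral_eq_sub_of_hasDerivAt_of_le hr.le (by fun_prop) hD
      (Continuous.intervalIntegrable (by fun_prop) _ _)
    rw [intervalIntegral.integral_add (d3.intervalIntegrable _ _) hk,
      h.apply_zero (Ioo_subset_Icc_self ht)] at this
    simp only [localKinetic]
    simp at this
    linarith

end IsClassicalWaveMap

/-! ### The virial estimate -/

namespace IsClassicalWaveMap

variable {n : ℤ} {T : ℝ} {φ : ℝ → ℝ → ℝ}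

lemma continuousOn_localEnergy (h : IsClassicalWaveMap n T φ) {ρ ρ' : ℝ → ℝ} {S : Set ℝ}
    (hS : S ⊆ Ioo 0 T) (hρ0 : ∀ t ∈ S, 0 ≤ ρ t) (hρ : ∀ t, HasDerivAt ρ (ρ' t) t) :
    ContinuousOn (fun t => localEnergy φ t (ρ t)) S := by
  intro t ht
  rcases (hρ0 t ht).eq_or_lt with h0 | h0
  · have hz : localEnergy φ t (ρ t) = 0 := by rw [← h0]; simp [localEnergy]
    obtain ⟨C, hC⟩ := h.exists_energyDensity_bound (hS ht) 1
    have hρt : Tendsto ρ (𝓝[S] t) (𝓝 0) := by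
      have := (hρ t).continuousAt.tendsto.mono_left (nhdsWithin_le_nhds (s := S))
      rwa [← h0] at this
    have hlim : Tendsto (fun t => C * |ρ t - 0|) (𝓝[S] t) (𝓝 0) := by
      simpa using ((hρt.abs).const_mul C)
    rw [ContinuousWithinAt, hz]
    refine squeeze_zero_norm' ?_ hlim
    filter_upwards [nhdsWithin_le_nhds hC, self_mem_nhdsWithin,
      hρt.eventually (gt_mem_nhds one_pos)] with t' h1 h2 h3
    refine intervalIntegral.norm_integral_le_of_norm_le_const fun s hs => ?_
    rw [uIoc_of_le (hρ0 t' h2)] at hs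
    exact h1 s ⟨hs.1, hs.2.trans h3.le⟩
  · exact (h.hasDerivAt_localEnergy (hS ht) h0 (hρ t)).continuousAt.continuousWithinAt

/-- The virial identity along an outgoing light ray. Its boundary term is at most `r / 2` times the
energy flux through the ray. -/
theorem integral_localKinetic_add_localVirial_le (h : IsClassicalWaveMap n T φ) {A s₁ s₂ : ℝ}
    (hA : 0 < A) (h1 : A ≤ s₁) (h12 : s₁ ≤ s₂) (h2 : s₂ < T) :
    (∫ t in s₁..s₂, localKinetic φ t (t - A)) + localVirial φ s₂ (s₂ - A)
        - localVirial φ s₁ (s₁ - A)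
      ≤ (s₂ - A) / 2 * (localEnergy φ s₂ (s₂ - A) - localEnergy φ s₁ (s₁ - A)) := by
  have hk : Continuous (fun t => localKinetic φ t (t - A)) :=
    h.continuous_localKinetic.comp (continuous_id.prodMk (continuous_id.sub continuous_const))
  have hY : Continuous (fun t => localVirial φ t (t - A)) :=
    h.continuous_localVirial.comp (continuous_id.prodMk (continuous_id.sub continuous_const))
  have hρ : ∀ t : ℝ, HasDerivAt (fun t => t - A) 1 t := fun t => (hasDerivAt_id t).sub_const A
  have hsub : Icc s₁ s₂ ⊆ Ioo 0 T := fun t ht => ⟨by linarith [ht.1], by linarith [ht.2]⟩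
  have hd : ∀ t ∈ Ioo s₁ s₂, HasDerivAt (fun t => (∫ τ in s₁..t, localKinetic φ τ (τ - A))
      + localVirial φ t (t - A) - (s₂ - A) / 2 * localEnergy φ t (t - A))
      (localKinetic φ t (t - A) + (((t - A) ^ 2 * (timeDeriv φ t (t - A) ^ 2
        + radDeriv φ t (t - A) ^ 2) - Real.sin (φ t (t - A)) ^ 2) / 2
        - localKinetic φ t (t - A)
        + 1 * ((t - A) ^ 2 * timeDeriv φ t (t - A) * radDeriv φ t (t - A)))
        - (s₂ - A) / 2 * outFlux φ t (t - A)) t := by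
    intro t ht
    have htA : A < t := h1.trans_lt ht.1
    have htI := hsub (Ioo_subset_Icc_self ht)
    exact ((intervalIntegral.integral_hasDerivAt_right (hk.intervalIntegrable _ _)
      (hk.stronglyMeasurableAtFilter _ _) hk.continuousAt).fun_add
      (h.hasDerivAt_localVirial htI (by linarith) (hρ t))).fun_sub
      ((h.hasDerivAt_localEnergy_outgoing htI htA).const_mul _)
  have hanti := antitoneOn_of_deriv_nonpos (convex_Icc s₁ s₂)
    (f := fun t => (∫ τ in s₁..t, localKinetic φ τ (τ - A))
      + localVirial φ t (t - A) - (s₂ - A) / 2 * localEnergy φ t (t - A)) ?_ ?_ ?_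
  · have := hanti (left_mem_Icc.2 h12) (right_mem_Icc.2 h12) h12
    simp only [intervalIntegral.integral_same] at this
    linarith
  · refine ((Continuous.continuousOn ?_).add hY.continuousOn).sub
      (continuousOn_const.mul (h.continuousOn_localEnergy hsub ?_ hρ))
    · exact intervalIntegral.continuous_primitive (fun a b => hk.intervalIntegrable a b) _
    · intro t ht; linarith [ht.1]
  · rw [interior_Icc]
    exact fun t ht => (hd t ht).differentiableAt.differentiableWithinAt
  · rw [interior_Icc]
    intro t ht
    rw [(hd t ht).deriv]
    have htA : 0 < t - A := by linarith [ht.1]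
    have hle : (t - A) / 2 * outFlux φ t (t - A) ≤ (s₂ - A) / 2 * outFlux φ t (t - A) :=
      mul_le_mul_of_nonneg_right (by linarith [ht.2]) (outFlux_nonneg φ htA.le)
    have heq : (t - A) / 2 * outFlux φ t (t - A) = ((t - A) ^ 2
        * (timeDeriv φ t (t - A) + radDeriv φ t (t - A)) ^ 2
        + Real.sin (φ t (t - A)) ^ 2) / 2 := by
      unfold outFlux; field_simp
    nlinarith [sq_nonneg (Real.sin (φ t (t - A)))]

/-- The virial identity along an incoming light ray. Its boundary term is at most `r / 2` times the
energy flux through the ray. -/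
theorem localVirial_sub_le (h : IsClassicalWaveMap n T φ) {u s₁ s₂ : ℝ}
    (h1 : 0 < s₁) (h12 : s₁ ≤ s₂) (h2 : s₂ ≤ u) (hu : u < T) :
    localVirial φ s₂ (u - s₂) - localVirial φ s₁ (u - s₁)
      ≤ (u - s₁) / 2 * (localEnergy φ s₁ (u - s₁) - localEnergy φ s₂ (u - s₂)) := by
  have hY : Continuous (fun t => localVirial φ t (u - t)) :=
    h.continuous_localVirial.comp (continuous_id.prodMk (continuous_const.sub continuous_id))
  have hρ : ∀ t : ℝ, HasDerivAt (fun t => u - t) (-1) t := fun t => (hasDerivAt_id t).const_sub u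
  have hsub : Icc s₁ s₂ ⊆ Ioo 0 T := fun t ht => ⟨by linarith [ht.1], by linarith [ht.2]⟩
  have hd : ∀ t ∈ Ioo s₁ s₂, HasDerivAt (fun t => localVirial φ t (u - t)
      + (u - s₁) / 2 * localEnergy φ t (u - t))
      (((u - t) ^ 2 * (timeDeriv φ t (u - t) ^ 2
        + radDeriv φ t (u - t) ^ 2) - Real.sin (φ t (u - t)) ^ 2) / 2
        - localKinetic φ t (u - t)
        + (-1) * ((u - t) ^ 2 * timeDeriv φ t (u - t) * radDeriv φ t (u - t))
        + (u - s₁) / 2 * (-inFlux φ t (u - t))) t := by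
    intro t ht
    have htu : t < u := ht.2.trans_le h2
    have htI := hsub (Ioo_subset_Icc_self ht)
    exact (h.hasDerivAt_localVirial htI (by linarith) (hρ t)).fun_add
      ((h.hasDerivAt_localEnergy_incoming htI htu).const_mul _)
  have hanti := antitoneOn_of_deriv_nonpos (convex_Icc s₁ s₂)
    (f := fun t => localVirial φ t (u - t) + (u - s₁) / 2 * localEnergy φ t (u - t)) ?_ ?_ ?_
  · have := hanti (left_mem_Icc.2 h12) (right_mem_Icc.2 h12) h12
    simp only at this
    linarith
  · refine hY.continuousOn.add (continuousOn_const.mul (h.continuousOn_localEnergy hsub ?_ hρ))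
    intro t ht; linarith [ht.2]
  · rw [interior_Icc]
    exact fun t ht => (hd t ht).differentiableAt.differentiableWithinAt
  · rw [interior_Icc]
    intro t ht
    rw [(hd t ht).deriv]
    have htu : 0 < u - t := by linarith [ht.2]
    have hle : (u - t) / 2 * inFlux φ t (u - t) ≤ (u - s₁) / 2 * inFlux φ t (u - t) :=
      mul_le_mul_of_nonneg_right (by linarith [ht.1]) (inFlux_nonneg φ htu.le)
    have heq : (u - t) / 2 * inFlux φ t (u - t) = ((u - t) ^ 2
        * (timeDeriv φ t (u - t) - radDeriv φ t (u - t)) ^ 2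
        + Real.sin (φ t (u - t)) ^ 2) / 2 := by
      unfold inFlux; field_simp
    nlinarith [sq_nonneg (Real.sin (φ t (u - t))), localKinetic_nonneg φ t htu.le]

/-- The energy in the balls cut out by an outgoing light cone is nondecreasing. -/
lemma localEnergy_outgoing_mono (h : IsClassicalWaveMap n T φ) {v s₁ s₂ : ℝ}
    (h1 : 0 < s₁) (hv : v ≤ s₁) (h12 : s₁ ≤ s₂) (h2 : s₂ < T) :
    localEnergy φ s₁ (s₁ - v) ≤ localEnergy φ s₂ (s₂ - v) := by
  have hρ : ∀ t : ℝ, HasDerivAt (fun t => t - v) 1 t := fun t => (hasDerivAt_id t).sub_const v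
  have hsub : Icc s₁ s₂ ⊆ Ioo 0 T := fun t ht => ⟨by linarith [ht.1], by linarith [ht.2]⟩
  have hd : ∀ t ∈ Ioo s₁ s₂, HasDerivAt (fun t => localEnergy φ t (t - v))
      (outFlux φ t (t - v)) t := fun t ht =>
    h.hasDerivAt_localEnergy_outgoing (hsub (Ioo_subset_Icc_self ht)) (by linarith [ht.1])
  refine monotoneOn_of_deriv_nonneg (convex_Icc s₁ s₂)
    (f := fun t => localEnergy φ t (t - v)) (h.continuousOn_localEnergy hsub ?_ hρ) ?_ ?_
    (left_mem_Icc.2 h12) (right_mem_Icc.2 h12) h12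
  · intro t ht; linarith [ht.1]
  · rw [interior_Icc]
    exact fun t ht => (hd t ht).differentiableAt.differentiableWithinAt
  · rw [interior_Icc]
    intro t ht
    rw [(hd t ht).deriv]
    exact outFlux_nonneg φ (by linarith [ht.1])

/-- The energy in the balls cut out by an incoming light cone is nonincreasing. -/
lemma localEnergy_incoming_anti (h : IsClassicalWaveMap n T φ) {u s₁ s₂ : ℝ}
    (h1 : 0 < s₁) (h12 : s₁ ≤ s₂) (hu : s₂ ≤ u) (h2 : s₂ < T) :
    localEnergy φ s₂ (u - s₂) ≤ localEnergy φ s₁ (u - s₁) := by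
  have hρ : ∀ t : ℝ, HasDerivAt (fun t => u - t) (-1) t := fun t => (hasDerivAt_id t).const_sub u
  have hsub : Icc s₁ s₂ ⊆ Ioo 0 T := fun t ht => ⟨by linarith [ht.1], by linarith [ht.2]⟩
  have hd : ∀ t ∈ Ioo s₁ s₂, HasDerivAt (fun t => localEnergy φ t (u - t))
      (-inFlux φ t (u - t)) t := fun t ht =>
    h.hasDerivAt_localEnergy_incoming (hsub (Ioo_subset_Icc_self ht)) (by linarith [ht.2])
  refine antitoneOn_of_deriv_nonpos (convex_Icc s₁ s₂)
    (f := fun t => localEnergy φ t (u - t)) (h.continuousOn_localEnergy hsub ?_ hρ) ?_ ?_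
    (left_mem_Icc.2 h12) (right_mem_Icc.2 h12) h12
  · intro t ht; linarith [ht.2]
  · rw [interior_Icc]
    exact fun t ht => (hd t ht).differentiableAt.differentiableWithinAt
  · rw [interior_Icc]
    intro t ht
    rw [(hd t ht).deriv]
    linarith [inFlux_nonneg φ (t := t) (r := u - t) (by linarith [ht.2])]

/-- The virial estimate in the cone `r < t - A`, `t ≤ S`. On the outgoing boundary the time `s₀`
separates a part of bounded radius; the incoming boundary issuing from the tip `(S, S - A)` is
split at the radius `ρ`. -/
theorem integral_localKinetic_le (h : IsClassicalWaveMap n T φ) {A s₀ S ρ : ℝ} (hA : 0 < A)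
    (h0 : A ≤ s₀) (h0S : s₀ ≤ S) (hρ0 : 0 ≤ ρ) (hρ : ρ ≤ S - A) (hT : 2 * S - A < T) :
    ∫ t in A..S, localKinetic φ t (t - A) ≤
      (s₀ - A) / 2 * localEnergy φ s₀ (s₀ - A)
      + (S - A) / 2 * (localEnergy φ S (S - A) - localEnergy φ s₀ (s₀ - A))
      + (S - A) / 2 * (localEnergy φ S (S - A) - localEnergy φ (2 * S - A - ρ) ρ)
      + ρ / 2 * localEnergy φ (2 * S - A - ρ) ρ := by
  have hk : Continuous (fun t => localKinetic φ t (t - A)) :=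
    h.continuous_localKinetic.comp (continuous_id.prodMk (continuous_id.sub continuous_const))
  have e1 := h.integral_localKinetic_add_localVirial_le hA le_rfl h0 (by linarith)
  have e2 := h.integral_localKinetic_add_localVirial_le hA h0 h0S (by linarith)
  have e3 := h.localVirial_sub_le (u := 2 * S - A) (s₁ := S) (s₂ := 2 * S - A - ρ)
    (by linarith) (by linarith) (by linarith) hT
  have e4 := h.localVirial_sub_le (u := 2 * S - A) (s₁ := 2 * S - A - ρ) (s₂ := 2 * S - A)
    (by linarith) (by linarith) (by linarith) hT
  have z1 : localEnergy φ A (A - A) = 0 := by simp [localEnergy]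
  have z2 : localVirial φ A (A - A) = 0 := by simp [localVirial]
  have z3 : localEnergy φ (2 * S - A) (2 * S - A - (2 * S - A)) = 0 := by simp [localEnergy]
  have z4 : localVirial φ (2 * S - A) (2 * S - A - (2 * S - A)) = 0 := by simp [localVirial]
  rw [z1, z2] at e1
  rw [z3, z4, show 2 * S - A - (2 * S - A - ρ) = ρ by ring] at e4
  rw [show 2 * S - A - (2 * S - A - ρ) = ρ by ring, show 2 * S - A - S = S - A by ring] at e3
  have hsum := intervalIntegral.integral_add_adjacent_intervals
    (hk.intervalIntegrable (μ := volume) A s₀) (hk.intervalIntegrable s₀ S)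
  linarith

end IsClassicalWaveMap

/-! ### The self-similar region -/

/-- A weighted energy estimate in the rectangle `[u₁, u₂] × [A, V]` of characteristic coordinates
`u = t + r`, `v = t - r`. The fluxes `a` and `b` satisfy `∂_v a = -∂_u b` together with the bound
`|∂_v a| ≤ C √(a b) / r`, and the divergence of the current with components
`z (1 - ρ / (u - v)) b` and `-z a`, where `z = exp (-24 (v - A) / ρ)`, is nonnegative. -/
theorem characteristic_rectangle_estimate {a b : ℝ × ℝ → ℝ} {l : ℝ → ℝ → ℝ} {u₁ u₂ A V ρ : ℝ}
    (hρ : 0 < ρ) (hAV : A ≤ V) (hu : u₁ ≤ u₂) (hr : 2 * ρ ≤ u₁ - V)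
    (ha : ContDiffOn ℝ 1 a {p | p.2 < p.1}) (hb : ContDiffOn ℝ 1 b {p | p.2 < p.1})
    (ha0 : ∀ p : ℝ × ℝ, p.2 < p.1 → 0 ≤ a p) (hb0 : ∀ p : ℝ × ℝ, p.2 < p.1 → 0 ≤ b p)
    (hda : ∀ u ∈ Icc u₁ u₂, ∀ v ∈ Icc A V, HasDerivAt (fun v => a (u, v)) (l u v) v)
    (hdb : ∀ u ∈ Icc u₁ u₂, ∀ v ∈ Icc A V, HasDerivAt (fun u => b (u, v)) (-l u v) u)
    (hl : ∀ u ∈ Icc u₁ u₂, ∀ v ∈ Icc A V, l u v ^ 2 ≤ 24 * (a (u, v) * b (u, v)) / (u - v) ^ 2) :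
    Real.exp (-(24 / ρ * (V - A))) / 2 * ∫ v in A..V, b (u₁, v) ≤
      (∫ v in A..V, b (u₂, v)) + ∫ u in u₁..u₂, a (u, A) := by
  have hO : IsOpen {p : ℝ × ℝ | p.2 < p.1} := isOpen_lt continuous_snd continuous_fst
  set z : ℝ × ℝ → ℝ := fun p => Real.exp (-(24 / ρ * (p.2 - A))) with hz
  set f : ℝ × ℝ → ℝ := fun p => z p * (1 - ρ / (p.1 - p.2)) * b p with hf
  set g : ℝ × ℝ → ℝ := fun p => -(z p * a p) with hg
  have hzc : ContDiff ℝ 1 z := by fun_prop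
  have hfc : ContDiffOn ℝ 1 f {p | p.2 < p.1} := by
    refine (hzc.contDiffOn.mul (contDiffOn_const.sub (contDiffOn_const.div ?_ ?_))).mul hb
    · exact (contDiff_fst.sub contDiff_snd).contDiffOn
    · intro p hp
      exact ne_of_gt (sub_pos.2 hp)
  have hgc : ContDiffOn ℝ 1 g {p | p.2 < p.1} := (hzc.contDiffOn.mul ha).neg
  have hrect : Icc u₁ u₂ ×ˢ Icc A V ⊆ {p : ℝ × ℝ | p.2 < p.1} := by
    rintro ⟨u, v⟩ ⟨h1, h2⟩
    have := h1.1; have := h2.2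
    change v < u
    linarith
  have hfd : ∀ p ∈ {p : ℝ × ℝ | p.2 < p.1}, HasFDerivAt f (fderiv ℝ f p) p := fun p hp =>
    ((hfc.differentiableOn one_ne_zero).differentiableAt (hO.mem_nhds hp)).hasFDerivAt
  have hgd : ∀ p ∈ {p : ℝ × ℝ | p.2 < p.1}, HasFDerivAt g (fderiv ℝ g p) p := fun p hp =>
    ((hgc.differentiableOn one_ne_zero).differentiableAt (hO.mem_nhds hp)).hasFDerivAt
  have hdivc : ContinuousOn (fun p => fderiv ℝ f p (1, 0) + fderiv ℝ g p (0, 1))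
      (Icc u₁ u₂ ×ˢ Icc A V) :=
    ((((hfc.continuousOn_fderiv_of_isOpen hO le_rfl).clm_apply continuousOn_const).add
      ((hgc.continuousOn_fderiv_of_isOpen hO le_rfl).clm_apply continuousOn_const))).mono hrect
  have hdiv : ∀ u ∈ Icc u₁ u₂, ∀ v ∈ Icc A V,
      0 ≤ fderiv ℝ f (u, v) (1, 0) + fderiv ℝ g (u, v) (0, 1) := by
    intro u hu v hv
    have hp : ((u, v) : ℝ × ℝ) ∈ {p : ℝ × ℝ | p.2 < p.1} := hrect ⟨hu, hv⟩
    have huv : 0 < u - v := sub_pos.2 hp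
    have huv2 : 2 * ρ ≤ u - v := by linarith [hu.1, hv.2]
    have f1 := (hfd _ hp).comp_hasDerivAt u ((hasDerivAt_id u).prodMk (hasDerivAt_const u v))
    have f2 : HasDerivAt (fun u => f (u, v)) (z (u, v) * (ρ / (u - v) ^ 2) * b (u, v)
        + z (u, v) * (1 - ρ / (u - v)) * (-l u v)) u := by
      have := (((((hasDerivAt_const u ρ).fun_div ((hasDerivAt_id u).sub_const v)
        (ne_of_gt huv)).const_sub 1).const_mul (z (u, v)))).fun_mul (hdb u hu v hv)
      refine this.congr_deriv ?_
      simp only [id]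
      ring
    have g1 := (hgd _ hp).comp_hasDerivAt v ((hasDerivAt_const v u).prodMk (hasDerivAt_id v))
    have g2 : HasDerivAt (fun v => g (u, v)) (z (u, v) * (24 / ρ) * a (u, v)
        - z (u, v) * l u v) v := by
      have := (((((hasDerivAt_id v).sub_const A).const_mul (24 / ρ)).fun_neg.exp).fun_mul
        (hda u hu v hv)).fun_neg
      refine this.congr_deriv ?_
      simp only [hz, id]
      ring
    rw [f1.unique f2, g1.unique g2]
    have hz0 : 0 < z (u, v) := Real.exp_pos _
    have hX : 0 ≤ ρ / (u - v) ^ 2 * b (u, v) := mul_nonneg (by positivity) (hb0 _ hp)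
    have hY : 0 ≤ 24 / ρ * a (u, v) := mul_nonneg (by positivity) (ha0 _ hp)
    have hw1 : 0 ≤ ρ / (u - v) := by positivity
    have hw2 : ρ / (u - v) ≤ 1 := by rw [div_le_one huv]; linarith
    -- The rate `24 / ρ` in `z` lets Young's inequality absorb the cross term.
    have hsq : ((2 - ρ / (u - v)) * l u v) ^ 2 ≤
        (ρ / (u - v) ^ 2 * b (u, v) + 24 / ρ * a (u, v)) ^ 2 := by
      have k1 : (2 - ρ / (u - v)) ^ 2 ≤ 4 := by nlinarith
      have k2 : ((2 - ρ / (u - v)) * l u v) ^ 2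
          ≤ 4 * (24 * (a (u, v) * b (u, v)) / (u - v) ^ 2) := by
        rw [mul_pow]
        exact mul_le_mul k1 (hl u hu v hv) (sq_nonneg _) (by norm_num)
      have k3 : 4 * (24 * (a (u, v) * b (u, v)) / (u - v) ^ 2)
          = 4 * (ρ / (u - v) ^ 2 * b (u, v)) * (24 / ρ * a (u, v)) := by field_simp
      nlinarith [sq_nonneg (ρ / (u - v) ^ 2 * b (u, v) - 24 / ρ * a (u, v))]
    have hle := abs_le_of_sq_le_sq' hsq (by positivity)
    have : z (u, v) * (ρ / (u - v) ^ 2) * b (u, v) + z (u, v) * (1 - ρ / (u - v)) * (-l u v)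
        + (z (u, v) * (24 / ρ) * a (u, v) - z (u, v) * l u v)
        = z (u, v) * (ρ / (u - v) ^ 2 * b (u, v) + 24 / ρ * a (u, v)
          - (2 - ρ / (u - v)) * l u v) := by ring
    rw [this]
    exact mul_nonneg hz0.le (by linarith [hle.2])
  have key := integral2_divergence_prod_of_hasFDerivAt f g (fderiv ℝ f) (fderiv ℝ g) u₁ A u₂ V
    (by rw [uIcc_of_le hu, uIcc_of_le hAV]; exact hfc.continuousOn.mono hrect)
    (by rw [uIcc_of_le hu, uIcc_of_le hAV]; exact hgc.continuousOn.mono hrect)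
    (by
      intro p hp
      rw [min_eq_left hu, max_eq_right hu, min_eq_left hAV, max_eq_right hAV] at hp
      exact hfd p (hrect ⟨Ioo_subset_Icc_self hp.1, Ioo_subset_Icc_self hp.2⟩))
    (by
      intro p hp
      rw [min_eq_left hu, max_eq_right hu, min_eq_left hAV, max_eq_right hAV] at hp
      exact hgd p (hrect ⟨Ioo_subset_Icc_self hp.1, Ioo_subset_Icc_self hp.2⟩))
    (by
      rw [uIcc_of_le hu, uIcc_of_le hAV]
      exact hdivc.integrableOn_compact (isCompact_Icc.prod isCompact_Icc))
  have hnn : 0 ≤ ∫ x in u₁..u₂, ∫ y in A..V, fderiv ℝ f (x, y) (1, 0)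
      + fderiv ℝ g (x, y) (0, 1) :=
    intervalIntegral.integral_nonneg hu fun x hx =>
      intervalIntegral.integral_nonneg hAV fun y hy => hdiv x hx y hy
  rw [key] at hnn
  have hmem1 : ∀ v ∈ Icc A V, ∀ u ∈ Icc u₁ u₂, v < u := fun v hv u hu => by
    linarith [hv.2, hu.1]
  have hslice : ∀ {F : ℝ × ℝ → ℝ}, ContinuousOn F {p | p.2 < p.1} → ∀ u ∈ Icc u₁ u₂,
      IntervalIntegrable (fun v => F (u, v)) volume A V := by
    intro F hF u hu
    refine ContinuousOn.intervalIntegrable ?_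
    rw [uIcc_of_le hAV]
    exact ContinuousOn.comp (f := fun v : ℝ => (u, v)) hF (by fun_prop)
      (fun v hv => hmem1 v hv u hu)
  have hg2 : ∫ x in u₁..u₂, g (x, V) ≤ 0 := by
    have : 0 ≤ ∫ x in u₁..u₂, -g (x, V) :=
      intervalIntegral.integral_nonneg hu fun x hx => by
        have := mul_nonneg (Real.exp_pos (-(24 / ρ * (V - A)))).le
          (ha0 (x, V) (hmem1 V (right_mem_Icc.2 hAV) x hx))
        simpa [hg, hz] using this
    rw [intervalIntegral.integral_neg] at this
    linarith
  have hg1 : ∫ x in u₁..u₂, g (x, A) = -∫ u in u₁..u₂, a (u, A) := by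
    rw [← intervalIntegral.integral_neg]
    simp [hg, hz]
  have hf2 : ∫ y in A..V, f (u₂, y) ≤ ∫ v in A..V, b (u₂, v) := by
    refine intervalIntegral.integral_mono_on hAV
      (hslice hfc.continuousOn u₂ (right_mem_Icc.2 hu))
      (hslice hb.continuousOn u₂ (right_mem_Icc.2 hu)) fun v hv => ?_
    have hvu := hmem1 v hv u₂ (right_mem_Icc.2 hu)
    have h1 : z (u₂, v) ≤ 1 := by
      simp only [hz]
      rw [Real.exp_le_one_iff]
      have : 0 ≤ 24 / ρ * (v - A) := mul_nonneg (by positivity) (by linarith [hv.1])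
      linarith
    have h2 : 1 - ρ / (u₂ - v) ≤ 1 := by
      have : 0 ≤ ρ / (u₂ - v) := div_nonneg hρ.le (by linarith)
      linarith
    have h3 : 0 ≤ 1 - ρ / (u₂ - v) := by
      rw [sub_nonneg, div_le_one (by linarith)]
      linarith [hv.2]
    exact mul_le_of_le_one_left (hb0 _ hvu) (mul_le_one₀ h1 h3 h2)
  have hf1 : Real.exp (-(24 / ρ * (V - A))) / 2 * ∫ v in A..V, b (u₁, v)
      ≤ ∫ y in A..V, f (u₁, y) := by
    rw [← intervalIntegral.integral_const_mul]
    refine intervalIntegral.integral_mono_on hAV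
      ((hslice hb.continuousOn u₁ (left_mem_Icc.2 hu)).const_mul _)
      (hslice hfc.continuousOn u₁ (left_mem_Icc.2 hu)) fun v hv => ?_
    have hvu := hmem1 v hv u₁ (left_mem_Icc.2 hu)
    have h1 : Real.exp (-(24 / ρ * (V - A))) ≤ z (u₁, v) := by
      simp only [hz]
      refine Real.exp_le_exp.2 (neg_le_neg ?_)
      exact mul_le_mul_of_nonneg_left (by linarith [hv.2]) (by positivity)
    have h2 : 1 / 2 ≤ 1 - ρ / (u₁ - v) := by
      have : ρ / (u₁ - v) ≤ 1 / 2 := by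
        rw [div_le_div_iff₀ (by linarith) (by norm_num)]
        linarith [hv.2]
      linarith
    refine mul_le_mul_of_nonneg_right ?_ (hb0 _ hvu)
    rw [div_eq_mul_one_div]
    exact mul_le_mul h1 h2 (by norm_num) (Real.exp_pos _).le
  linarith

namespace IsClassicalWaveMap

variable {n : ℤ} {T : ℝ} {φ : ℝ → ℝ → ℝ}

/-- The energy that crosses the incoming ray from `(S, S - A)` to `(S + d, S - A - d)` is controlled
by the energy that crosses the later incoming ray from `(S', S' - A)` to `(S' + d, S' - A - d)` and
by the flux through the outgoing cone `r = t - A` between the times `S` and `S'`. The constant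
depends only on the ratio of `d` to a lower bound `ρ` of the radius, which makes the estimate
invariant under scaling. -/
theorem incoming_flux_le (h : IsClassicalWaveMap n T φ) {A S S' d ρ : ℝ} (hA : 0 < A)
    (hd : 0 ≤ d) (hρ : 0 < ρ) (hr : ρ ≤ S - A - d) (hS : S ≤ S') (hT : S' + d < T) :
    localEnergy φ S (S - A) - localEnergy φ (S + d) (S - A - d) ≤
      2 * Real.exp (48 * d / ρ) *
        ((localEnergy φ S' (S' - A) - localEnergy φ (S' + d) (S' - A - d))
          + (localEnergy φ S' (S' - A) - localEnergy φ S (S - A))) := by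
  have c0 := h.contDiff_one
  have c1 := h.contDiff_timeDeriv
  have c2 := h.contDiff_radDeriv
  set a : ℝ × ℝ → ℝ := fun p => outFlux φ ((p.1 + p.2) / 2) ((p.1 - p.2) / 2) with ha
  set b : ℝ × ℝ → ℝ := fun p => inFlux φ ((p.1 + p.2) / 2) ((p.1 - p.2) / 2) with hb
  have hchange : ContDiff ℝ 1 (fun p : ℝ × ℝ => ((p.1 + p.2) / 2, (p.1 - p.2) / 2)) := by
    fun_prop
  have d0 : ContDiff ℝ 1 (fun p : ℝ × ℝ => φ ((p.1 + p.2) / 2) ((p.1 - p.2) / 2)) :=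
    c0.comp hchange
  have d1 : ContDiff ℝ 1 (fun p : ℝ × ℝ => timeDeriv φ ((p.1 + p.2) / 2) ((p.1 - p.2) / 2)) :=
    c1.comp hchange
  have d2 : ContDiff ℝ 1 (fun p : ℝ × ℝ => radDeriv φ ((p.1 + p.2) / 2) ((p.1 - p.2) / 2)) :=
    c2.comp hchange
  have hac : ContDiffOn ℝ 1 a {p | p.2 < p.1} := by
    simp only [ha, outFlux]
    refine ContDiffOn.add (ContDiff.contDiffOn (by fun_prop))
      (ContDiffOn.div (ContDiff.contDiffOn (by fun_prop))
      (ContDiff.contDiffOn (by fun_prop)) ?_)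
    intro p hp
    exact ne_of_gt (half_pos (sub_pos.2 hp))
  have hbc : ContDiffOn ℝ 1 b {p | p.2 < p.1} := by
    simp only [hb, inFlux]
    refine ContDiffOn.add (ContDiff.contDiffOn (by fun_prop))
      (ContDiffOn.div (ContDiff.contDiffOn (by fun_prop))
      (ContDiff.contDiffOn (by fun_prop)) ?_)
    intro p hp
    exact ne_of_gt (half_pos (sub_pos.2 hp))
  -- `l` is `∂_v a = -∂_u b`, computed from the equation; the second derivatives cancel.
  set l : ℝ → ℝ → ℝ := fun u v =>
    (radDeriv φ ((u + v) / 2) ((u - v) / 2) ^ 2 - timeDeriv φ ((u + v) / 2) ((u - v) / 2) ^ 2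
      + Real.sin (φ ((u + v) / 2) ((u - v) / 2)) ^ 2 / ((u - v) / 2) ^ 2
      - 4 * Real.sin (φ ((u + v) / 2) ((u - v) / 2)) * Real.cos (φ ((u + v) / 2) ((u - v) / 2))
        * radDeriv φ ((u + v) / 2) ((u - v) / 2) / ((u - v) / 2)) / 2 with hl
  have hin : ∀ u ∈ Icc (2 * S - A) (2 * S' - A), ∀ v ∈ Icc A (A + 2 * d),
      (u + v) / 2 ∈ Icc 0 T ∧ 0 < (u - v) / 2 := by
    intro u hu v hv
    obtain ⟨u1, u2⟩ := hu
    obtain ⟨v1, v2⟩ := hv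
    refine ⟨⟨by linarith, by linarith⟩, by linarith⟩
  have main := characteristic_rectangle_estimate (a := a) (b := b) (l := l) (u₁ := 2 * S - A)
    (u₂ := 2 * S' - A) (A := A) (V := A + 2 * d) hρ (by linarith) (by linarith) (by linarith)
    hac hbc (fun p hp => outFlux_nonneg φ (half_pos (sub_pos.2 hp)).le)
    (fun p hp => inFlux_nonneg φ (half_pos (sub_pos.2 hp)).le) ?_ ?_ ?_
  · have i1 : ∀ s, S ≤ s → s ≤ S' → ∫ v in A..(A + 2 * d), b (2 * s - A, v)
        = 2 * (localEnergy φ s (s - A) - localEnergy φ (s + d) (s - A - d)) := by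
      intro s hs1 hs2
      have hder : ∀ v ∈ uIcc A (A + 2 * d), HasDerivAt
          (fun v => -2 * localEnergy φ ((2 * s - A + v) / 2) (2 * s - A - (2 * s - A + v) / 2))
          (b (2 * s - A, v)) v := by
        intro v hv
        rw [uIcc_of_le (by linarith)] at hv
        have hI : (2 * s - A + v) / 2 ∈ Ioo 0 T :=
          ⟨by linarith [hv.1], by linarith [hv.2]⟩
        have e := h.hasDerivAt_localEnergy_incoming (u := 2 * s - A) hI (by linarith [hv.2])
        have := (e.comp v (((hasDerivAt_id v).const_add (2 * s - A)).div_const 2)).const_mul (-2)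
        refine this.congr_deriv ?_
        simp only [hb]
        rw [show 2 * s - A - (2 * s - A + v) / 2 = (2 * s - A - v) / 2 by ring]
        ring
      rw [intervalIntegral.integral_eq_sub_of_hasDerivAt hder]
      · rw [show (2 * s - A + (A + 2 * d)) / 2 = s + d by ring,
          show (2 * s - A + A) / 2 = s by ring, show 2 * s - A - (s + d) = s - A - d by ring,
          show 2 * s - A - s = s - A by ring]
        ring
      · refine ContinuousOn.intervalIntegrable ?_
        rw [uIcc_of_le (by linarith)]
        refine ContinuousOn.comp (f := fun v : ℝ => (2 * s - A, v)) hbc.continuousOn (by fun_prop)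
          (fun v hv => ?_)
        change v < 2 * s - A
        linarith [hv.2]
    have i2 : ∫ u in (2 * S - A)..(2 * S' - A), a (u, A)
        = 2 * (localEnergy φ S' (S' - A) - localEnergy φ S (S - A)) := by
      have hder : ∀ u ∈ uIcc (2 * S - A) (2 * S' - A), HasDerivAt
          (fun u => 2 * localEnergy φ ((u + A) / 2) ((u + A) / 2 - A)) (a (u, A)) u := by
        intro u hu
        rw [uIcc_of_le (by linarith)] at hu
        have hI : (u + A) / 2 ∈ Ioo 0 T :=
          ⟨by linarith [hu.1], by linarith [hu.2]⟩
        have e := h.hasDerivAt_localEnergy_outgoing (v := A) hI (by linarith [hu.1])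
        have := (e.comp u (((hasDerivAt_id u).add_const A).div_const 2)).const_mul 2
        refine this.congr_deriv ?_
        simp only [ha]
        rw [show (u + A) / 2 - A = (u - A) / 2 by ring]
        ring
      rw [intervalIntegral.integral_eq_sub_of_hasDerivAt hder]
      · rw [show (2 * S' - A + A) / 2 = S' by ring, show (2 * S - A + A) / 2 = S by ring]
        ring
      · refine ContinuousOn.intervalIntegrable ?_
        rw [uIcc_of_le (by linarith)]
        refine ContinuousOn.comp (f := fun u : ℝ => (u, A)) hac.continuousOn (by fun_prop)
          (fun u hu => ?_)
        change A < u
        linarith [hu.1]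
    rw [i1 S le_rfl hS, i1 S' hS le_rfl, i2, show 24 / ρ * (A + 2 * d - A) = 48 * d / ρ by ring,
      Real.exp_neg] at main
    have hE := Real.exp_pos (48 * d / ρ)
    have := mul_le_mul_of_nonneg_left main hE.le
    field_simp at this
    linarith
  · intro u hu v hv
    obtain ⟨ht, hr0⟩ := hin u hu v hv
    have hα : HasDerivAt (fun v => (u + v) / 2) (1 / 2) v :=
      ((hasDerivAt_id v).const_add u).div_const 2
    have hβ : HasDerivAt (fun v => (u - v) / 2) (-1 / 2) v :=
      ((hasDerivAt_id v).const_sub u).div_const 2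
    have e0 := hasDerivAt_along_curve c0 hα hβ
    have e1 := hasDerivAt_along_curve c1 hα hβ
    have e2 := hasDerivAt_along_curve c2 hα hβ
    have := (hβ.fun_mul ((e1.fun_add e2).fun_pow 2)).fun_add
      ((e0.sin.fun_pow 2).fun_div hβ hr0.ne')
    refine this.congr_deriv ?_
    rw [timeDeriv_radDeriv_comm h.contDiff, h.wave_eq ht hr0]
    simp only [hl]
    generalize (u - v) / 2 = r at *
    generalize (u + v) / 2 = t at *
    field_simp
    ring
  · intro u hu v hv
    obtain ⟨ht, hr0⟩ := hin u hu v hv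
    have hα : HasDerivAt (fun u => (u + v) / 2) (1 / 2) u :=
      ((hasDerivAt_id u).add_const v).div_const 2
    have hβ : HasDerivAt (fun u => (u - v) / 2) (1 / 2) u :=
      ((hasDerivAt_id u).sub_const v).div_const 2
    have e0 := hasDerivAt_along_curve c0 hα hβ
    have e1 := hasDerivAt_along_curve c1 hα hβ
    have e2 := hasDerivAt_along_curve c2 hα hβ
    have := (hβ.fun_mul ((e1.fun_sub e2).fun_pow 2)).fun_add
      ((e0.sin.fun_pow 2).fun_div hβ hr0.ne')
    refine this.congr_deriv ?_
    rw [timeDeriv_radDeriv_comm h.contDiff, h.wave_eq ht hr0]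
    simp only [hl]
    generalize (u - v) / 2 = r at *
    generalize (u + v) / 2 = t at *
    field_simp
    ring
  · intro u hu v hv
    obtain ⟨ht, hr0⟩ := hin u hu v hv
    have huv : (u - v) ^ 2 = 4 * ((u - v) / 2) ^ 2 := by ring
    simp only [hl, ha, hb, outFlux, inFlux]
    rw [huv]
    generalize (u - v) / 2 = r at *
    generalize (u + v) / 2 = t at *
    generalize timeDeriv φ t r = x
    generalize radDeriv φ t r = y
    have hc := Real.cos_sq_le_one (φ t r)
    generalize Real.cos (φ t r) = c at *
    obtain ⟨q, hq⟩ : ∃ q, Real.sin (φ t r) = q * r := ⟨Real.sin (φ t r) / r, by field_simp⟩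
    rw [hq]
    have g1 : 24 * ((r * (x + y) ^ 2 + (q * r) ^ 2 / r) * (r * (x - y) ^ 2 + (q * r) ^ 2 / r))
        / (4 * r ^ 2) = 6 * ((x ^ 2 - y ^ 2) ^ 2 + 2 * q ^ 2 * (x ^ 2 + y ^ 2) + q ^ 4) := by
      field_simp
      ring
    have g2 : ((y ^ 2 - x ^ 2 + (q * r) ^ 2 / r ^ 2 - 4 * (q * r) * c * y / r) / 2) ^ 2
        = ((y ^ 2 - x ^ 2) + q ^ 2 - 4 * q * c * y) ^ 2 / 4 := by
      field_simp
      ring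
    rw [g1, g2]
    have g3 : ((y ^ 2 - x ^ 2) + q ^ 2 - 4 * q * c * y) ^ 2
        ≤ 3 * ((y ^ 2 - x ^ 2) ^ 2 + (q ^ 2) ^ 2 + (4 * q * c * y) ^ 2) := by
      nlinarith [sq_nonneg ((y ^ 2 - x ^ 2) - q ^ 2), sq_nonneg ((y ^ 2 - x ^ 2) + 4 * q * c * y),
        sq_nonneg (q ^ 2 + 4 * q * c * y)]
    have g4 : (4 * q * c * y) ^ 2 ≤ 16 * (q ^ 2 * y ^ 2) := by
      have := mul_le_mul_of_nonneg_left hc (by positivity : 0 ≤ 16 * (q ^ 2 * y ^ 2))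
      nlinarith
    nlinarith [sq_nonneg (q * x), sq_nonneg (q * y), sq_nonneg (x ^ 2 - y ^ 2), sq_nonneg (q ^ 2)]

end IsClassicalWaveMap

/-! ### Stability of the local energies -/

/-- The energy of the pair `(f, g)` in the ball of radius `ρ`. -/
noncomputable def ballEnergy (f g : ℝ → ℝ) (ρ : ℝ) : ℝ≥0∞ :=
  ∫⁻ r in Ioo 0 ρ, ENNReal.ofReal ((g r ^ 2 + deriv f r ^ 2 + Real.sin (f r) ^ 2 / r ^ 2) * r)

lemma ballEnergy_le_waveEnergy (f g : ℝ → ℝ) (ρ : ℝ) : ballEnergy f g ρ ≤ waveEnergy f g :=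
  lintegral_mono_set Ioo_subset_Ioi_self

lemma ballEnergy_mono (f g : ℝ → ℝ) {ρ₁ ρ₂ : ℝ} (h : ρ₁ ≤ ρ₂) :
    ballEnergy f g ρ₁ ≤ ballEnergy f g ρ₂ :=
  lintegral_mono_set (Ioo_subset_Ioo_right h)

lemma normHL2Sq_sub_comm (f₁ f₂ g₁ g₂ : ℝ → ℝ) :
    normHL2Sq (fun r => f₁ r - f₂ r) (fun r => g₁ r - g₂ r)
      = normHL2Sq (fun r => f₂ r - f₁ r) (fun r => g₂ r - g₁ r) := by
  have h : (fun r => f₁ r - f₂ r) = fun r => -(f₂ r - f₁ r) := by ext; ring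
  simp only [normHL2Sq, h, deriv.fun_neg, neg_sq]
  simp only [sub_sq_comm (g₁ _) (g₂ _), sub_sq_comm (f₁ _) (f₂ _)]

/-- Young's inequality for `p = q + (p - q)`, where `|p - q| ≤ |d|`. -/
lemma sq_le_add_mul_sq {η p q d : ℝ} (hη : 0 < η) (h : (p - q) ^ 2 ≤ d ^ 2) :
    p ^ 2 ≤ (1 + η) * q ^ 2 + (1 + 1 / η) * d ^ 2 := by
  have h1 : p ^ 2 ≤ (1 + η) * q ^ 2 + (1 + 1 / η) * (p - q) ^ 2 := by
    have : (1 + η) * q ^ 2 + (1 + 1 / η) * (p - q) ^ 2 - p ^ 2 = (η * q - (p - q)) ^ 2 / η := by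
      field_simp; ring
    have : 0 ≤ (η * q - (p - q)) ^ 2 / η := by positivity
    linarith
  have h2 : 0 ≤ 1 + 1 / η := by positivity
  linarith [mul_le_mul_of_nonneg_left h h2]

namespace MemEnergyClass

variable {n : ℤ} {f g f₁ g₁ f₂ g₂ : ℝ → ℝ}

lemma continuousOn (h : MemEnergyClass n f g) : ContinuousOn f (Ioi 0) := by
  intro r hr
  have hr : 0 < r := hr
  have hc := (h.absCont (r / 2) (2 * r) (by linarith) (by linarith)).continuousOn
  rw [uIcc_of_le (by linarith)] at hc
  exact (hc.continuousAt (Icc_mem_nhds (by linarith) (by linarith))).continuousWithinAt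

lemma ae_differentiableAt (h : MemEnergyClass n f g) :
    ∀ᵐ r : ℝ, 0 < r → DifferentiableAt ℝ f r := by
  have : ∀ᵐ r : ℝ, ∀ m : ℕ, r ∈ uIcc (1 / ((m : ℝ) + 1)) ((m : ℝ) + 1) →
      DifferentiableAt ℝ f r := by
    rw [ae_all_iff]
    intro m
    have hm : (1 : ℝ) ≤ (m : ℝ) + 1 := by linarith [(Nat.cast_nonneg m : (0 : ℝ) ≤ m)]
    refine (h.absCont _ _ (by positivity) ?_).ae_differentiableAt
    exact (div_le_one (by linarith)).2 hm |>.trans hm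
  filter_upwards [this] with r hr h0
  obtain ⟨m₁, hm₁⟩ := exists_nat_ge r
  obtain ⟨m₂, hm₂⟩ := exists_nat_ge (1 / r)
  refine hr (max m₁ m₂) ?_
  have c1 : (m₁ : ℝ) ≤ (max m₁ m₂ : ℕ) := by exact_mod_cast le_max_left _ _
  have c2 : (m₂ : ℝ) ≤ (max m₁ m₂ : ℕ) := by exact_mod_cast le_max_right _ _
  have c3 : 1 / (((max m₁ m₂ : ℕ) : ℝ) + 1) ≤ r := by
    rw [div_le_iff₀ (by positivity)]
    rw [div_le_iff₀ h0] at hm₂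
    nlinarith
  rw [uIcc_of_le (by linarith)]
  exact ⟨c3, by linarith⟩

lemma aemeasurable_density (h : MemEnergyClass n f g) {s : Set ℝ} (hs : s ⊆ Ioi 0)
    (hm : MeasurableSet s) :
    AEMeasurable (fun r => ENNReal.ofReal
      ((g r ^ 2 + deriv f r ^ 2 + Real.sin (f r) ^ 2 / r ^ 2) * r)) (volume.restrict s) := by
  have h1 : AEMeasurable g (volume.restrict s) :=
    (h.aesm.mono_measure (Measure.restrict_mono hs le_rfl)).aemeasurable
  have h2 : AEMeasurable f (volume.restrict s) := (h.continuousOn.mono hs).aemeasurable hm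
  have h3 : Measurable (deriv f) := measurable_deriv f
  have h4 := Real.measurable_sin.comp_aemeasurable h2
  exact ((((h1.pow_const 2).add (h3.aemeasurable.pow_const 2)).add
    ((h4.pow_const 2).div (by fun_prop))).mul aemeasurable_id).ennreal_ofReal

/-- The square root of the local energy is a Lipschitz function of the pair: a quantitative
version with Young's inequality. -/
theorem ballEnergy_le (h₁ : MemEnergyClass n f₁ g₁) (h₂ : MemEnergyClass n f₂ g₂) {η : ℝ}
    (hη : 0 < η) (ρ : ℝ) :
    ballEnergy f₁ g₁ ρ ≤ ENNReal.ofReal (1 + η) * ballEnergy f₂ g₂ ρ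
      + ENNReal.ofReal (1 + 1 / η)
        * normHL2Sq (fun r => f₁ r - f₂ r) (fun r => g₁ r - g₂ r) := by
  have hle : normHL2Sq (fun r => f₁ r - f₂ r) (fun r => g₁ r - g₂ r) ≥ ∫⁻ r in Ioo 0 ρ,
      ENNReal.ofReal (((g₁ r - g₂ r) ^ 2 + deriv (fun r => f₁ r - f₂ r) r ^ 2
        + (f₁ r - f₂ r) ^ 2 / r ^ 2) * r) := lintegral_mono_set Ioo_subset_Ioi_self
  refine le_trans ?_ (add_le_add_right (mul_le_mul_right hle _) _)
  unfold ballEnergy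
  rw [← lintegral_const_mul' _ _ ENNReal.ofReal_ne_top,
    ← lintegral_const_mul' _ _ ENNReal.ofReal_ne_top,
    ← lintegral_add_left' ((h₂.aemeasurable_density Ioo_subset_Ioi_self
      measurableSet_Ioo).const_mul _)]
  refine lintegral_mono_ae ?_
  filter_upwards [ae_restrict_mem measurableSet_Ioo, ae_restrict_of_ae h₁.ae_differentiableAt,
    ae_restrict_of_ae h₂.ae_differentiableAt] with r hr hd1 hd2
  have hr0 : 0 < r := hr.1
  have hη1 : 0 < 1 + 1 / η := by positivity
  rw [deriv_fun_sub (hd1 hr0) (hd2 hr0), ← ENNReal.ofReal_mul (by positivity),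
    ← ENNReal.ofReal_mul hη1.le, ← ENNReal.ofReal_add (by positivity) (by positivity)]
  refine ENNReal.ofReal_le_ofReal ?_
  have e1 := sq_le_add_mul_sq hη (le_refl ((g₁ r - g₂ r) ^ 2))
  have e2 := sq_le_add_mul_sq hη (le_refl ((deriv f₁ r - deriv f₂ r) ^ 2))
  have e3 : Real.sin (f₁ r) ^ 2 ≤ (1 + η) * Real.sin (f₂ r) ^ 2
      + (1 + 1 / η) * (f₁ r - f₂ r) ^ 2 := by
    refine sq_le_add_mul_sq hη (sq_le_sq.2 ?_)
    rw [Real.sin_sub_sin, abs_mul, abs_mul, abs_two]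
    have s1 : |Real.sin ((f₁ r - f₂ r) / 2)| ≤ |f₁ r - f₂ r| / 2 := by
      have := Real.abs_sin_le_abs (x := (f₁ r - f₂ r) / 2)
      rwa [abs_div, abs_two] at this
    have s2 := Real.abs_cos_le_one ((f₁ r + f₂ r) / 2)
    nlinarith [abs_nonneg (Real.sin ((f₁ r - f₂ r) / 2)), abs_nonneg (f₁ r - f₂ r),
      abs_nonneg (Real.cos ((f₁ r + f₂ r) / 2))]
  have e4 := div_le_div_of_nonneg_right e3 (sq_nonneg r)
  have e5 := mul_le_mul_of_nonneg_right (add_le_add (add_le_add e1 e2) e4) hr0.le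
  refine e5.trans (le_of_eq ?_)
  ring

end MemEnergyClass

/-- Convergence from a two-sided comparison with arbitrarily small relative error. -/
lemma tendsto_of_relative_comparison {x δ : ℕ → ℝ} {y : ℝ} (hx : ∀ k, 0 ≤ x k) (hy : 0 ≤ y)
    (hδ : Tendsto δ atTop (𝓝 0))
    (h1 : ∀ η, 0 < η → ∀ᶠ k in atTop, x k ≤ (1 + η) * y + (1 + 1 / η) * δ k)
    (h2 : ∀ η, 0 < η → ∀ᶠ k in atTop, y ≤ (1 + η) * x k + (1 + 1 / η) * δ k) :
    Tendsto x atTop (𝓝 y) := by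
  have hlim : ∀ η c : ℝ, Tendsto (fun k => c + (1 + 1 / η) * δ k) atTop (𝓝 c) := fun η c => by
    simpa using (hδ.const_mul (1 + 1 / η)).const_add c
  rw [tendsto_order]
  constructor
  · intro a ha
    rcases lt_or_ge a 0 with h0 | h0
    · exact Eventually.of_forall fun k => h0.trans_le (hx k)
    · have hη : 0 < (y - a) / (2 * (a + 1)) := by
        have : 0 < y - a := by linarith
        positivity
      have hη2 : (1 + (y - a) / (2 * (a + 1))) * a < y := by
        have : (y - a) / (2 * (a + 1)) * a ≤ (y - a) / 2 := by
          rw [div_mul_eq_mul_div, div_le_div_iff₀ (by positivity) (by norm_num)]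
          nlinarith
        linarith
      filter_upwards [h2 _ hη, (hlim ((y - a) / (2 * (a + 1)))
        ((1 + (y - a) / (2 * (a + 1))) * a)).eventually (gt_mem_nhds hη2)] with k k1 k2
      refine lt_of_mul_lt_mul_left (a := 1 + (y - a) / (2 * (a + 1))) ?_ (by positivity)
      linarith
  · intro b hb
    have hη : 0 < (b - y) / (2 * (y + 1)) := by
      have : 0 < b - y := by linarith
      positivity
    have hη2 : (1 + (b - y) / (2 * (y + 1))) * y < b := by
      have : (b - y) / (2 * (y + 1)) * y ≤ (b - y) / 2 := by
        rw [div_mul_eq_mul_div, div_le_div_iff₀ (by positivity) (by norm_num)]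
        nlinarith
      linarith
    filter_upwards [h1 _ hη, (hlim ((b - y) / (2 * (y + 1)))
      ((1 + (b - y) / (2 * (y + 1))) * y)).eventually (gt_mem_nhds hη2)] with k k1 k2
    exact k1.trans_lt k2

namespace IsClassicalWaveMap

variable {n : ℤ} {T : ℝ} {φ : ℝ → ℝ → ℝ}

lemma ballEnergy_eq (h : IsClassicalWaveMap n T φ) {t ρ : ℝ} (ht : t ∈ Ioo 0 T) (hρ : 0 ≤ ρ) :
    ballEnergy (φ t) (timeDeriv φ t) ρ = ENNReal.ofReal (localEnergy φ t ρ) := by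
  have hi := h.intervalIntegrable_energyDensity ht hρ
  rw [intervalIntegrable_iff_integrableOn_Ioo_of_le hρ] at hi
  rw [localEnergy, intervalIntegral.integral_of_le hρ, integral_Ioc_eq_integral_Ioo,
    ofReal_integral_eq_lintegral_ofReal hi]
  · refine setLIntegral_congr_fun measurableSet_Ioo fun r hr => ?_
    have hr0 : 0 < r := hr.1
    simp only [energyDensity, radDeriv]
    congr 1
    field_simp
  · filter_upwards [ae_restrict_mem measurableSet_Ioo] with r hr
    exact energyDensity_nonneg φ hr.1.le

lemma continuous_kineticDensity (h : IsClassicalWaveMap n T φ) (t : ℝ) :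
    Continuous (fun s => s * timeDeriv φ t s ^ 2) := by
  have : Continuous (timeDeriv φ t) := h.continuous_timeDeriv.comp (Continuous.prodMk_right t)
  fun_prop

lemma kineticEnergy_eq (h : IsClassicalWaveMap n T φ) {t ρ : ℝ} (hρ : 0 ≤ ρ) :
    kineticEnergy (timeDeriv φ) t ρ = ENNReal.ofReal (localKinetic φ t ρ) := by
  have hi := (h.continuous_kineticDensity t).intervalIntegrable (μ := volume) 0 ρ
  rw [intervalIntegrable_iff_integrableOn_Ioo_of_le hρ] at hi
  rw [localKinetic, intervalIntegral.integral_of_le hρ, integral_Ioc_eq_integral_Ioo,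
    ofReal_integral_eq_lintegral_ofReal hi]
  · refine setLIntegral_congr_fun measurableSet_Ioo fun r hr => ?_
    simp only [mul_comm]
  · filter_upwards [ae_restrict_mem measurableSet_Ioo] with r hr
    exact mul_nonneg hr.1.le (sq_nonneg _)

/-- Kinetic energies in balls are comparable up to the `H × L²` distance. As only the term of `φ` has
to be measurable, `ψt` is arbitrary. -/
lemma kineticEnergy_le (h : IsClassicalWaveMap n T φ) (ψ ψt : ℝ → ℝ → ℝ) {t ρ : ℝ} (hρ : 0 ≤ ρ) :
    kineticEnergy ψt t ρ ≤ 2 * ENNReal.ofReal (localKinetic φ t ρ)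
      + 2 * normHL2Sq (fun r => ψ t r - φ t r) (fun r => ψt t r - timeDeriv φ t r) := by
  rw [← h.kineticEnergy_eq hρ]
  have hle : normHL2Sq (fun r => ψ t r - φ t r) (fun r => ψt t r - timeDeriv φ t r) ≥
      ∫⁻ r in Ioo 0 ρ, ENNReal.ofReal ((ψt t r - timeDeriv φ t r) ^ 2 * r) := by
    refine (lintegral_mono_set Ioo_subset_Ioi_self).trans
      (setLIntegral_mono' measurableSet_Ioi fun r hr => ENNReal.ofReal_le_ofReal ?_)
    refine mul_le_mul_of_nonneg_right ?_ (le_of_lt hr)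
    rw [add_assoc]
    exact le_add_of_nonneg_right (by positivity)
  refine le_trans ?_ (add_le_add_right (mul_le_mul_right hle _) _)
  unfold kineticEnergy
  have hm : Measurable fun r => 2 * ENNReal.ofReal (timeDeriv φ t r ^ 2 * r) := by
    have : Continuous (timeDeriv φ t) := h.continuous_timeDeriv.comp (Continuous.prodMk_right t)
    exact (Continuous.measurable (by fun_prop)).ennreal_ofReal.const_mul 2
  rw [← lintegral_const_mul' _ _ ENNReal.ofNat_ne_top,
    ← lintegral_const_mul' _ _ ENNReal.ofNat_ne_top, ← lintegral_add_left hm]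
  refine setLIntegral_mono' measurableSet_Ioo fun r hr => ?_
  have hr0 : 0 < r := hr.1
  rw [← ENNReal.ofReal_ofNat 2, ← ENNReal.ofReal_mul (by norm_num),
    ← ENNReal.ofReal_mul (by norm_num), ← ENNReal.ofReal_add (by positivity) (by positivity)]
  refine ENNReal.ofReal_le_ofReal ?_
  nlinarith [mul_nonneg hr0.le (sq_nonneg (ψt t r - 2 * timeDeriv φ t r))]

/-- The time integral of the kinetic energy in the cone `r < t - A`, bounded by energies in balls
at the times `1`, `s₀`, `S` and `S'`. -/
theorem integral_localKinetic_le_energies (h : IsClassicalWaveMap n T φ) {A s₀ S S' θ : ℝ}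
    (hA : 1 ≤ A) (h0 : A ≤ s₀) (h0S : s₀ ≤ S) (hθ : 0 < θ) (hAS : A ≤ (1 - θ) * S)
    (hS : 2 * S ≤ S') (hT : S' + S < T) :
    ∫ t in A..S, localKinetic φ t (t - A) ≤
      s₀ * localEnergy φ s₀ (s₀ - A)
      + S * (localEnergy φ S (S - A) - localEnergy φ s₀ (s₀ - A))
      + S * (2 * Real.exp (48 / θ) * (2 * localEnergy φ S' (S' - A)
        - localEnergy φ S' (S' - (2 * (1 - θ) * S - A)) - localEnergy φ S (S - A)))
      + θ * S * localEnergy φ 1 (2 * S - A - 1) := by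
  have hS0 : 0 < S := by linarith
  have hθS : 0 < θ * S := by positivity
  set d := (1 - θ) * S - A with hd
  have m1 := h.integral_localKinetic_le (A := A) (s₀ := s₀) (S := S) (ρ := θ * S) (by linarith)
    h0 h0S hθS.le (by linarith) (by linarith)
  have m2 := h.incoming_flux_le (A := A) (S := S) (S' := S') (d := d) (ρ := θ * S) (by linarith)
    (by linarith) hθS (by linarith) (by linarith) (by linarith)
  have m3 := h.localEnergy_outgoing_mono (v := A + 2 * d) (s₁ := S') (s₂ := S' + d)
    (by linarith) (by linarith) (by linarith) (by linarith)
  have m4 := h.localEnergy_incoming_anti (u := 2 * S - A) (s₁ := 1) (s₂ := S + d)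
    (by linarith) (by linarith) (by linarith) (by linarith)
  have m5 := h.localEnergy_outgoing_mono (v := A) (s₁ := s₀) (s₂ := S)
    (by linarith) (by linarith) (by linarith) (by linarith)
  have m6 := h.localEnergy_outgoing_mono (v := A) (s₁ := S) (s₂ := S')
    (by linarith) (by linarith) (by linarith) (by linarith)
  have r1 : S - A - d = θ * S := by rw [hd]; ring
  have r2 : 2 * S - A - θ * S = S + d := by rw [hd]; ring
  have r3 : S' - (A + 2 * d) = S' - (2 * (1 - θ) * S - A) := by rw [hd]; ring
  have r4 : S' + d - (A + 2 * d) = S' - A - d := by ring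
  have r5 : 2 * S - A - (S + d) = θ * S := by rw [hd]; ring
  rw [r1] at m2
  rw [r2] at m1
  rw [r3, r4] at m3
  rw [r5] at m4
  have hexp : Real.exp (48 * d / (θ * S)) ≤ Real.exp (48 / θ) := by
    refine Real.exp_le_exp.2 ?_
    rw [div_le_div_iff₀ hθS hθ]
    have : d ≤ S := by nlinarith
    nlinarith
  have hn1 := localEnergy_nonneg φ s₀ (ρ := s₀ - A) (by linarith)
  have hn2 := localEnergy_nonneg φ (S + d) (ρ := θ * S) hθS.le
  have m7 := h.localEnergy_incoming_anti (u := 2 * S' - A) (s₁ := S') (s₂ := S' + d)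
    (by linarith) (by linarith) (by linarith) (by linarith)
  rw [show 2 * S' - A - (S' + d) = S' - A - d by ring, show 2 * S' - A - S' = S' - A by ring] at m7
  set X := (localEnergy φ S' (S' - A) - localEnergy φ (S' + d) (S' - A - d))
    + (localEnergy φ S' (S' - A) - localEnergy φ S (S - A)) with hX
  set Y := 2 * localEnergy φ S' (S' - A)
    - localEnergy φ S' (S' - (2 * (1 - θ) * S - A)) - localEnergy φ S (S - A) with hY
  have hX0 : 0 ≤ X := by rw [hX]; linarith
  have hXY : X ≤ Y := by rw [hX, hY]; linarith
  have hm : 2 * Real.exp (48 * d / (θ * S)) * X ≤ 2 * Real.exp (48 / θ) * Y :=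
    mul_le_mul (by linarith) hXY hX0 (by positivity)
  have hY0 : 0 ≤ 2 * Real.exp (48 / θ) * Y := mul_nonneg (by positivity) (hX0.trans hXY)
  have p1 : (s₀ - A) / 2 * localEnergy φ s₀ (s₀ - A) ≤ s₀ * localEnergy φ s₀ (s₀ - A) :=
    mul_le_mul_of_nonneg_right (by linarith) hn1
  have p2 : (S - A) / 2 * (localEnergy φ S (S - A) - localEnergy φ s₀ (s₀ - A))
      ≤ S * (localEnergy φ S (S - A) - localEnergy φ s₀ (s₀ - A)) :=
    mul_le_mul_of_nonneg_right (by linarith) (by linarith)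
  have p3 : (S - A) / 2 * (localEnergy φ S (S - A) - localEnergy φ (S + d) (θ * S))
      ≤ S * (2 * Real.exp (48 / θ) * Y) :=
    (mul_le_mul_of_nonneg_left (m2.trans hm) (by linarith)).trans
      (mul_le_mul_of_nonneg_right (by linarith) hY0)
  have p4 : θ * S / 2 * localEnergy φ (S + d) (θ * S)
      ≤ θ * S * localEnergy φ 1 (2 * S - A - 1) :=
    mul_le_mul (by linarith) m4 hn2 hθS.le
  linarith

end IsClassicalWaveMap

/-! ### Wave maps in the energy class -/

section Limit

variable {n : ℤ} {T : ℝ} {ψ ψt : ℝ → ℝ → ℝ} {φ : ℕ → ℝ → ℝ → ℝ}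

/-- The `H × L²` distance, squared, between a trajectory `(ψ, ψt)` and a function `φ`, uniformly in
`t ∈ [0, T]`. -/
noncomputable def uniformDistSq (ψ ψt φ : ℝ → ℝ → ℝ) (T : ℝ) : ℝ≥0∞ :=
  ⨆ t ∈ Icc 0 T, normHL2Sq (fun r => ψ t r - φ t r) (fun r => ψt t r - timeDeriv φ t r)

lemma normHL2Sq_le_uniformDistSq (ψ ψt φ : ℝ → ℝ → ℝ) {t : ℝ} (ht : t ∈ Icc 0 T) :
    normHL2Sq (fun r => ψ t r - φ t r) (fun r => ψt t r - timeDeriv φ t r)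
      ≤ uniformDistSq ψ ψt φ T :=
  le_iSup₂ (f := fun t (_ : t ∈ Icc 0 T) =>
    normHL2Sq (fun r => ψ t r - φ t r) (fun r => ψt t r - timeDeriv φ t r)) t ht

lemma MemEnergyClass.ballEnergy_ne_top {f g : ℝ → ℝ} (h : MemEnergyClass n f g) (ρ : ℝ) :
    ballEnergy f g ρ ≠ ∞ := ((ballEnergy_le_waveEnergy f g ρ).trans_lt h.energy_lt_top).ne

theorem tendsto_localEnergy (hψ : ∀ t, 0 ≤ t → MemEnergyClass n (ψ t) (ψt t))
    (hφ : ∀ k, IsClassicalWaveMap n T (φ k))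
    (hlim : Tendsto (fun k => uniformDistSq ψ ψt (φ k) T) atTop (𝓝 0)) {t ρ : ℝ}
    (ht : t ∈ Ioo 0 T) (hρ : 0 ≤ ρ) :
    Tendsto (fun k => localEnergy (φ k) t ρ) atTop (𝓝 (ballEnergy (ψ t) (ψt t) ρ).toReal) := by
  have htc := Ioo_subset_Icc_self ht
  have hfin : ballEnergy (ψ t) (ψt t) ρ ≠ ∞ := (hψ t htc.1).ballEnergy_ne_top ρ
  have hev : ∀ᶠ k in atTop, uniformDistSq ψ ψt (φ k) T < ∞ :=
    hlim.eventually (gt_mem_nhds ENNReal.zero_lt_top)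
  have hδ : Tendsto (fun k => (uniformDistSq ψ ψt (φ k) T).toReal) atTop (𝓝 0) := by
    simpa [Function.comp_def] using (ENNReal.tendsto_toReal ENNReal.zero_ne_top).comp hlim
  refine tendsto_of_relative_comparison (fun k => localEnergy_nonneg _ _ hρ)
    ENNReal.toReal_nonneg hδ ?_ ?_
  all_goals
    intro η hη
    have hη1 : 0 ≤ 1 + 1 / η := by positivity
    filter_upwards [hev] with k hk
    have hn := localEnergy_nonneg (φ k) t hρ
    have hd := normHL2Sq_le_uniformDistSq ψ ψt (φ k) htc
  · have := ((hφ k).mem t htc).ballEnergy_le (hψ t htc.1) hη ρ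
    rw [normHL2Sq_sub_comm, (hφ k).ballEnergy_eq ht hρ] at this
    have := this.trans (add_le_add_right (mul_le_mul_right hd _) _)
    rw [← ENNReal.ofReal_toReal hfin, ← ENNReal.ofReal_toReal hk.ne,
      ← ENNReal.ofReal_mul (by positivity), ← ENNReal.ofReal_mul hη1,
      ← ENNReal.ofReal_add (by positivity) (by positivity),
      ENNReal.ofReal_le_ofReal_iff (by positivity)] at this
    exact this
  · have := (hψ t htc.1).ballEnergy_le ((hφ k).mem t htc) hη ρ
    rw [(hφ k).ballEnergy_eq ht hρ] at this
    have := this.trans (add_le_add_right (mul_le_mul_right hd _) _)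
    rw [← ENNReal.ofReal_toReal hfin, ← ENNReal.ofReal_toReal hk.ne,
      ← ENNReal.ofReal_mul (by positivity), ← ENNReal.ofReal_mul hη1,
      ← ENNReal.ofReal_add (by positivity) (by positivity),
      ENNReal.ofReal_le_ofReal_iff (by positivity)] at this
    exact this

/-- Bounds of the kinetic energy in a cone pass to the limit, up to a factor `2`. -/
theorem lintegral_kineticEnergy_le_of_tendsto (hφ : ∀ k, IsClassicalWaveMap n T (φ k))
    (hlim : Tendsto (fun k => uniformDistSq ψ ψt (φ k) T) atTop (𝓝 0)) {A S : ℝ}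
    (hA : 0 ≤ A) (hAS : A ≤ S) (hS : S ≤ T) {R : ℕ → ℝ} {R' : ℝ} (hR : Tendsto R atTop (𝓝 R'))
    (hk : ∀ k, ∫ t in A..S, localKinetic (φ k) t (t - A) ≤ R k) :
    ∫⁻ t in Ioc A S, kineticEnergy ψt t (t - A) ≤ 2 * ENNReal.ofReal R' := by
  have hbound : ∀ k, ∫⁻ t in Ioc A S, kineticEnergy ψt t (t - A)
      ≤ 2 * ENNReal.ofReal (R k) + 2 * uniformDistSq ψ ψt (φ k) T * ENNReal.ofReal (S - A) := by
    intro k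
    have hc : Continuous (fun t => localKinetic (φ k) t (t - A)) :=
      (hφ k).continuous_localKinetic.comp
        (continuous_id.prodMk (continuous_id.sub continuous_const))
    have hint := hc.intervalIntegrable (μ := volume) A S
    rw [intervalIntegrable_iff_integrableOn_Ioc_of_le hAS] at hint
    calc ∫⁻ t in Ioc A S, kineticEnergy ψt t (t - A)
        ≤ ∫⁻ t in Ioc A S, (2 * ENNReal.ofReal (localKinetic (φ k) t (t - A))
            + 2 * uniformDistSq ψ ψt (φ k) T) := by
          refine setLIntegral_mono' measurableSet_Ioc fun t ht => ?_
          refine ((hφ k).kineticEnergy_le ψ ψt (by linarith [ht.1])).trans ?_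
          exact add_le_add_right (mul_le_mul_right (normHL2Sq_le_uniformDistSq ψ ψt (φ k)
            ⟨hA.trans ht.1.le, ht.2.trans hS⟩) _) _
      _ = 2 * ENNReal.ofReal (∫ t in A..S, localKinetic (φ k) t (t - A))
            + 2 * uniformDistSq ψ ψt (φ k) T * ENNReal.ofReal (S - A) := by
          rw [lintegral_add_right _ measurable_const, lintegral_const,
            lintegral_const_mul' _ _ ENNReal.ofNat_ne_top, intervalIntegral.integral_of_le hAS,
            ofReal_integral_eq_lintegral_ofReal hint]
          · simp
          · filter_upwards [ae_restrict_mem measurableSet_Ioc] with t ht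
            exact localKinetic_nonneg _ _ (by linarith [ht.1])
      _ ≤ _ := add_le_add_left (mul_le_mul_right (ENNReal.ofReal_le_ofReal (hk k)) _) _
  have hlim2 : Tendsto (fun k => 2 * ENNReal.ofReal (R k)
      + 2 * uniformDistSq ψ ψt (φ k) T * ENNReal.ofReal (S - A)) atTop
      (𝓝 (2 * ENNReal.ofReal R' + 2 * 0 * ENNReal.ofReal (S - A))) := by
    refine Tendsto.add ?_ ?_
    · exact ENNReal.Tendsto.const_mul (ENNReal.tendsto_ofReal hR) (Or.inr ENNReal.ofNat_ne_top)
    · exact ENNReal.Tendsto.mul_const (ENNReal.Tendsto.const_mul hlim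
        (Or.inr ENNReal.ofNat_ne_top)) (Or.inr ENNReal.ofReal_ne_top)
  have := ge_of_tendsto' hlim2 hbound
  simpa using this

end Limit

/-- The energy of the trajectory `(ψ, ψt)` in the ball of radius `ρ` at time `t`, as a real
number. -/
noncomputable def trajectoryEnergy (ψ ψt : ℝ → ℝ → ℝ) (t ρ : ℝ) : ℝ :=
  (ballEnergy (ψ t) (ψt t) ρ).toReal

namespace IsGlobalWaveMap

variable {ψ ψt : ℝ → ℝ → ℝ}

/-- On `(0, T)` the local energies are limits of those of classical solutions that approximate the
trajectory uniformly. -/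
lemma exists_approximation (hψ : IsGlobalWaveMap ψ ψt) {T : ℝ} (hT : 0 < T) :
    ∃ (n : ℤ) (φ : ℕ → ℝ → ℝ → ℝ), (∀ k, IsClassicalWaveMap n T (φ k)) ∧
      Tendsto (fun k => uniformDistSq ψ ψt (φ k) T) atTop (𝓝 0) ∧
      ∀ t ∈ Ioo 0 T, ∀ ρ, 0 ≤ ρ →
        Tendsto (fun k => localEnergy (φ k) t ρ) atTop (𝓝 (trajectoryEnergy ψ ψt t ρ)) := by
  obtain ⟨n, hmem, happ⟩ := hψ
  obtain ⟨φ, hφ, hlim⟩ := happ T hT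
  exact ⟨n, φ, hφ, hlim, fun t ht ρ hρ => tendsto_localEnergy hmem hφ hlim ht hρ⟩

lemma trajectoryEnergy_outgoing_mono (hψ : IsGlobalWaveMap ψ ψt) {v s₁ s₂ : ℝ} (h1 : 0 < s₁)
    (hv : v ≤ s₁) (h12 : s₁ ≤ s₂) :
    trajectoryEnergy ψ ψt s₁ (s₁ - v) ≤ trajectoryEnergy ψ ψt s₂ (s₂ - v) := by
  obtain ⟨n, φ, hφ, -, hE⟩ := hψ.exists_approximation (T := s₂ + 1) (by linarith)
  exact le_of_tendsto_of_tendsto' (hE s₁ ⟨h1, by linarith⟩ _ (by linarith))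
    (hE s₂ ⟨by linarith, by linarith⟩ _ (by linarith))
    fun k => (hφ k).localEnergy_outgoing_mono h1 hv h12 (by linarith)

lemma trajectoryEnergy_incoming_anti (hψ : IsGlobalWaveMap ψ ψt) {u s₁ s₂ : ℝ} (h1 : 0 < s₁)
    (h12 : s₁ ≤ s₂) (hu : s₂ ≤ u) :
    trajectoryEnergy ψ ψt s₂ (u - s₂) ≤ trajectoryEnergy ψ ψt s₁ (u - s₁) := by
  obtain ⟨n, φ, hφ, -, hE⟩ := hψ.exists_approximation (T := s₂ + 1) (by linarith)
  exact le_of_tendsto_of_tendsto' (hE s₂ ⟨by linarith, by linarith⟩ _ (by linarith))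
    (hE s₁ ⟨h1, by linarith⟩ _ (by linarith))
    fun k => (hφ k).localEnergy_incoming_anti h1 h12 hu (by linarith)

lemma ballEnergy_ne_top (hψ : IsGlobalWaveMap ψ ψt) {t : ℝ} (ht : 0 ≤ t) (ρ : ℝ) :
    ballEnergy (ψ t) (ψt t) ρ ≠ ∞ := by
  obtain ⟨n, hmem, -⟩ := hψ
  exact (hmem t ht).ballEnergy_ne_top ρ

lemma trajectoryEnergy_mono_radius (hψ : IsGlobalWaveMap ψ ψt) {t ρ₁ ρ₂ : ℝ} (ht : 0 ≤ t)
    (h : ρ₁ ≤ ρ₂) : trajectoryEnergy ψ ψt t ρ₁ ≤ trajectoryEnergy ψ ψt t ρ₂ :=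
  ENNReal.toReal_mono (hψ.ballEnergy_ne_top ht _) (ballEnergy_mono _ _ h)

/-- By the monotonicity along incoming cones, all local energies at times `t ≥ 1` are bounded by the
energy at time `1`. -/
lemma trajectoryEnergy_le (hψ : IsGlobalWaveMap ψ ψt) {t : ℝ} (ht : 1 ≤ t) {ρ : ℝ} (hρ : 0 ≤ ρ) :
    trajectoryEnergy ψ ψt t ρ ≤ (waveEnergy (ψ 1) (ψt 1)).toReal := by
  have h1 := hψ.trajectoryEnergy_incoming_anti (u := t + ρ) one_pos ht (by linarith)
  rw [add_sub_cancel_left] at h1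
  refine h1.trans ?_
  obtain ⟨n, hmem, -⟩ := hψ
  exact ENNReal.toReal_mono (hmem 1 zero_le_one).energy_lt_top.ne (ballEnergy_le_waveEnergy _ _ _)

lemma trajectoryEnergy_nonneg (ψ ψt : ℝ → ℝ → ℝ) (t ρ : ℝ) : 0 ≤ trajectoryEnergy ψ ψt t ρ :=
  ENNReal.toReal_nonneg

theorem lintegral_kineticEnergy_le_energies (hψ : IsGlobalWaveMap ψ ψt) {A s₀ S S' θ : ℝ}
    (hA : 1 ≤ A) (h0 : A ≤ s₀) (h0S : s₀ ≤ S) (hθ : 0 < θ) (hAS : A ≤ (1 - θ) * S)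
    (hS : 2 * S ≤ S') :
    ∫⁻ t in Ioc A S, kineticEnergy ψt t (t - A) ≤ 2 * ENNReal.ofReal (
      s₀ * trajectoryEnergy ψ ψt s₀ (s₀ - A)
      + S * (trajectoryEnergy ψ ψt S (S - A) - trajectoryEnergy ψ ψt s₀ (s₀ - A))
      + S * (2 * Real.exp (48 / θ) * (2 * trajectoryEnergy ψ ψt S' (S' - A)
        - trajectoryEnergy ψ ψt S' (S' - (2 * (1 - θ) * S - A))
        - trajectoryEnergy ψ ψt S (S - A)))
      + θ * S * trajectoryEnergy ψ ψt 1 (2 * S - A - 1)) := by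
  have hθS : 0 < θ * S := mul_pos hθ (by linarith)
  obtain ⟨n, φ, hφ, hlim, hE⟩ := hψ.exists_approximation (T := S' + S + 1) (by linarith)
  have e1 := hE s₀ ⟨by linarith, by linarith⟩ (s₀ - A) (by linarith)
  have e2 := hE S ⟨by linarith, by linarith⟩ (S - A) (by linarith)
  have e3 := hE S' ⟨by linarith, by linarith⟩ (S' - A) (by linarith)
  have e4 := hE S' ⟨by linarith, by linarith⟩ (S' - (2 * (1 - θ) * S - A)) (by linarith)
  have e5 := hE 1 ⟨by linarith, by linarith⟩ (2 * S - A - 1) (by linarith)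
  exact lintegral_kineticEnergy_le_of_tendsto hφ hlim (by linarith) (by linarith) (by linarith)
    ((((e1.const_mul s₀).add ((e2.sub e1).const_mul S)).add
      (((((e3.const_mul 2).sub e4).sub e2).const_mul _).const_mul S)).add (e5.const_mul (θ * S)))
    fun k => (hφ k).integral_localKinetic_le_energies hA h0 h0S hθ hAS hS (by linarith)

/-- The energy in an outgoing cone converges, by monotonicity. -/
lemma exists_coneEnergy_limit (hψ : IsGlobalWaveMap ψ ψt) {v : ℝ} (hv : 1 ≤ v) :
    ∃ ℓ, Tendsto (fun t => trajectoryEnergy ψ ψt t (t - v)) atTop (𝓝 ℓ) ∧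
      ∀ t, v ≤ t → trajectoryEnergy ψ ψt t (t - v) ≤ ℓ := by
  set F : ℝ → ℝ := fun t => trajectoryEnergy ψ ψt (max t v) (max t v - v) with hF
  have hmono : Monotone F := fun s t hst =>
    hψ.trajectoryEnergy_outgoing_mono (lt_of_lt_of_le (by linarith) (le_max_right s v))
      (le_max_right _ _) (max_le_max_right v hst)
  have hbdd : BddAbove (range F) := by
    refine ⟨(waveEnergy (ψ 1) (ψt 1)).toReal, ?_⟩
    rintro _ ⟨t, rfl⟩
    exact hψ.trajectoryEnergy_le (hv.trans (le_max_right _ _)) (sub_nonneg.2 (le_max_right _ _))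
  refine ⟨⨆ t, F t, (tendsto_atTop_ciSup hmono hbdd).congr' ?_, fun t ht => ?_⟩
  · filter_upwards [eventually_ge_atTop v] with t ht
    simp only [hF, max_eq_left ht]
  · have := le_ciSup hbdd t
    simpa only [hF, max_eq_left ht] using this

/-- The kinetic energy in the cone `r < t - A` is small on time average, for large `A`. -/
theorem exists_lintegral_kineticEnergy_le (hψ : IsGlobalWaveMap ψ ψt) {ε : ℝ} (hε : 0 < ε) :
    ∃ A₀, 1 ≤ A₀ ∧ ∀ A, A₀ ≤ A → ∃ S₀, ∀ S, S₀ ≤ S →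
      ∫⁻ t in Ioc A S, kineticEnergy ψt t (t - A) ≤ ENNReal.ofReal (ε * S) := by
  set C := (waveEnergy (ψ 1) (ψt 1)).toReal with hC
  have hC0 : 0 ≤ C := ENNReal.toReal_nonneg
  have hex : ∀ v : ℝ, ∃ ℓ, 1 ≤ v → Tendsto (fun t => trajectoryEnergy ψ ψt t (t - v)) atTop (𝓝 ℓ) ∧
      ∀ t, v ≤ t → trajectoryEnergy ψ ψt t (t - v) ≤ ℓ := by
    intro v
    by_cases hv : 1 ≤ v
    · obtain ⟨ℓ, h⟩ := hψ.exists_coneEnergy_limit hv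
      exact ⟨ℓ, fun _ => h⟩
    · exact ⟨0, fun h => absurd h hv⟩
  choose ℓ hℓ using hex
  have hanti : ∀ v w, 1 ≤ v → v ≤ w → ℓ w ≤ ℓ v := by
    intro v w hv hvw
    refine le_of_tendsto_of_tendsto (hℓ w (hv.trans hvw)).1 (hℓ v hv).1 ?_
    filter_upwards [eventually_ge_atTop 0] with t ht
    exact hψ.trajectoryEnergy_mono_radius ht (by linarith)
  have hℓ0 : ∀ v, 1 ≤ v → 0 ≤ ℓ v := fun v hv =>
    ge_of_tendsto' (hℓ v hv).1 fun t => trajectoryEnergy_nonneg _ _ _ _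
  -- The limits decrease to their infimum; beyond `A₀` they vary by less than `δ`.
  have hcauchy : ∀ δ, 0 < δ → ∃ A₀, 1 ≤ A₀ ∧ ∀ v w, A₀ ≤ v → v ≤ w → ℓ v - ℓ w ≤ δ := by
    intro δ hδ
    have hne : (ℓ '' Ici 1).Nonempty := ⟨ℓ 1, 1, le_refl (1 : ℝ), rfl⟩
    have hbd : BddBelow (ℓ '' Ici 1) := ⟨0, by rintro _ ⟨v, hv, rfl⟩; exact hℓ0 v hv⟩
    obtain ⟨_, ⟨A₀, hA₀, rfl⟩, hlt⟩ :=
      exists_lt_of_csInf_lt hne (lt_add_of_pos_right (sInf (ℓ '' Ici 1)) hδ)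
    refine ⟨A₀, hA₀, fun v w hv hvw => ?_⟩
    have hA₀' : (1 : ℝ) ≤ A₀ := hA₀
    have h1 := hanti A₀ v hA₀' hv
    have h2 := csInf_le hbd ⟨w, (hA₀'.trans hv).trans hvw, rfl⟩
    linarith
  obtain ⟨θ, hθ, hθ1, hθC⟩ : ∃ θ, 0 < θ ∧ θ ≤ 1 / 2 ∧ θ * C ≤ ε / 10 := by
    refine ⟨min (1 / 2) (ε / (10 * (C + 1))), by positivity, min_le_left _ _, ?_⟩
    calc min (1 / 2) (ε / (10 * (C + 1))) * C ≤ ε / (10 * (C + 1)) * C :=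
          mul_le_mul_of_nonneg_right (min_le_right _ _) hC0
      _ ≤ ε / 10 := by
          rw [div_mul_eq_mul_div, div_le_div_iff₀ (by positivity) (by norm_num)]
          nlinarith
  set K := 2 * Real.exp (48 / θ) with hK
  have hK0 : 0 < K := by positivity
  obtain ⟨A₀, hA₀, hvar⟩ := hcauchy (ε / (10 * K)) (by positivity)
  refine ⟨A₀, hA₀, fun A hA => ?_⟩
  have hA1 : 1 ≤ A := hA₀.trans hA
  obtain ⟨hlimA, hleA⟩ := hℓ A hA1
  have hev : ∀ δ, 0 < δ → ∀ᶠ t in atTop, ℓ A - trajectoryEnergy ψ ψt t (t - A) ≤ δ := by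
    intro δ hδ
    filter_upwards [hlimA.eventually (lt_mem_nhds (sub_lt_self (ℓ A) hδ))] with t ht
    linarith
  obtain ⟨s₀, hs₀, hs₀A⟩ := ((hev (ε / 10) (by positivity)).and (eventually_ge_atTop A)).exists
  obtain ⟨S₁, hS₁⟩ := eventually_atTop.1 (hev (ε / (10 * K)) (by positivity))
  refine ⟨max (max S₁ (2 * A)) (max s₀ (s₀ * C / (ε / 10))), fun S hS => ?_⟩
  have q1 : S₁ ≤ S := ((le_max_left _ _).trans (le_max_left _ _)).trans hS
  have q2 : 2 * A ≤ S := ((le_max_right _ _).trans (le_max_left _ _)).trans hS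
  have q3 : s₀ ≤ S := ((le_max_left _ _).trans (le_max_right _ _)).trans hS
  have q4 : s₀ * C / (ε / 10) ≤ S := ((le_max_right _ _).trans (le_max_right _ _)).trans hS
  have hS0 : 0 < S := by linarith
  have hAS : A ≤ (1 - θ) * S := by nlinarith
  set V := 2 * (1 - θ) * S - A with hV
  have hVA : A ≤ V := by linarith
  have hbound := fun S' (hS' : 2 * S ≤ S') =>
    hψ.lintegral_kineticEnergy_le_energies hA1 hs₀A q3 hθ hAS hS'
  -- The last time `S'` is sent to infinity.
  have hlimit : ∫⁻ t in Ioc A S, kineticEnergy ψt t (t - A) ≤ 2 * ENNReal.ofReal (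
      s₀ * trajectoryEnergy ψ ψt s₀ (s₀ - A)
      + S * (trajectoryEnergy ψ ψt S (S - A) - trajectoryEnergy ψ ψt s₀ (s₀ - A))
      + S * (K * (2 * ℓ A - ℓ V - trajectoryEnergy ψ ψt S (S - A)))
      + θ * S * trajectoryEnergy ψ ψt 1 (2 * S - A - 1)) := by
    refine ge_of_tendsto (ENNReal.Tendsto.const_mul (ENNReal.tendsto_ofReal
      (((((((hlimA.const_mul 2).sub (hℓ V (hA1.trans hVA)).1).sub_const _).const_mul K).const_mul
        S).const_add _).add_const _)) (Or.inr ENNReal.ofNat_ne_top)) ?_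
    filter_upwards [eventually_ge_atTop (2 * S)] with S' hS'
    exact hbound S' hS'
  refine hlimit.trans ?_
  rw [← ENNReal.ofReal_ofNat 2, ← ENNReal.ofReal_mul (by norm_num)]
  refine ENNReal.ofReal_le_ofReal ?_
  have t1 : s₀ * trajectoryEnergy ψ ψt s₀ (s₀ - A) ≤ ε / 10 * S := by
    rw [div_le_iff₀ (by positivity)] at q4
    have := mul_le_mul_of_nonneg_left
      (hψ.trajectoryEnergy_le (hA1.trans hs₀A) (sub_nonneg.2 hs₀A)) (by linarith : 0 ≤ s₀)
    linarith
  have t2 : S * (trajectoryEnergy ψ ψt S (S - A) - trajectoryEnergy ψ ψt s₀ (s₀ - A))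
      ≤ S * (ε / 10) :=
    mul_le_mul_of_nonneg_left (by linarith [hleA S (by linarith)]) hS0.le
  have t3 : S * (K * (2 * ℓ A - ℓ V - trajectoryEnergy ψ ψt S (S - A))) ≤ S * (ε / 5) := by
    refine mul_le_mul_of_nonneg_left ?_ hS0.le
    have h1 := hvar A V hA hVA
    have h2 := hS₁ S q1
    have h3 : K * (2 * ℓ A - ℓ V - trajectoryEnergy ψ ψt S (S - A))
        ≤ K * (ε / (10 * K) + ε / (10 * K)) := mul_le_mul_of_nonneg_left (by linarith) hK0.le
    have h4 : K * (ε / (10 * K) + ε / (10 * K)) = ε / 5 := by field_simp; norm_num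
    linarith
  have t4 : θ * S * trajectoryEnergy ψ ψt 1 (2 * S - A - 1) ≤ S * (ε / 10) := by
    have h1 := hψ.trajectoryEnergy_le le_rfl (ρ := 2 * S - A - 1) (by linarith)
    have h2 := mul_le_mul_of_nonneg_left h1 (mul_pos hθ hS0).le
    have h3 := mul_le_mul_of_nonneg_left hθC hS0.le
    linarith
  linarith

end IsGlobalWaveMap

/-! ### A maximal function argument -/

/-- If the averages `(1/S) ∫_A^S f` are at most `ε` for large `S`, then there are arbitrarily large
times from which all forward averages of `f` are at most `2 ε`. Otherwise the set of times `t` with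
`∫_s^t f ≥ 2 ε (t - s)`, which is closed under increasing limits, would be unbounded, and the
averages over `(A, t]` along it would be close to `2 ε`. -/
theorem exists_forward_averages_le {f : ℝ → ℝ≥0∞} {A S₀ ε : ℝ} (hε : 0 < ε)
    (h : ∀ S, S₀ ≤ S → ∫⁻ t in Ioc A S, f t ≤ ENNReal.ofReal (ε * S)) (N : ℝ) :
    ∃ τ, N ≤ τ ∧ ∀ σ, 0 < σ → ∫⁻ t in Ioc τ (τ + σ), f t ≤ ENNReal.ofReal (2 * ε * σ) := by
  by_contra! hcon
  set s := max (max N A) 0 with hs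
  have hsN : N ≤ s := (le_max_left _ _).trans (le_max_left _ _)
  have hsA : A ≤ s := (le_max_right _ _).trans (le_max_left _ _)
  have hs0 : 0 ≤ s := le_max_right _ _
  set B : Set ℝ := {t | s ≤ t ∧ ENNReal.ofReal (2 * ε * (t - s)) ≤ ∫⁻ x in Ioc s t, f x} with hB
  have hsB : s ∈ B := ⟨le_rfl, by simp⟩
  have hbdd : BddAbove B := by
    refine ⟨max S₀ (2 * s), fun t ht => ?_⟩
    by_contra! hlt
    have h1 : S₀ ≤ t := (le_max_left _ _).trans hlt.le
    have h2 : 2 * s < t := (le_max_right _ _).trans_lt hlt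
    have h3 := (ht.2.trans (lintegral_mono_set (Ioc_subset_Ioc_left hsA))).trans (h t h1)
    rw [ENNReal.ofReal_le_ofReal_iff (by nlinarith)] at h3
    nlinarith
  set b := sSup B with hb
  have hsb : s ≤ b := le_csSup hbdd hsB
  have hbB : b ∈ B := by
    refine ⟨hsb, ?_⟩
    refine le_of_forall_lt fun c hc => ?_
    obtain ⟨c', hc', hc'lt⟩ : ∃ c' : ℝ, c < ENNReal.ofReal (2 * ε * (c' - s)) ∧ c' < b := by
      have hct : Tendsto (fun x => ENNReal.ofReal (2 * ε * (x - s))) (𝓝[<] b)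
          (𝓝 (ENNReal.ofReal (2 * ε * (b - s)))) := by
        have : Continuous (fun x => ENNReal.ofReal (2 * ε * (x - s))) :=
          ENNReal.continuous_ofReal.comp (by fun_prop)
        exact this.continuousAt.tendsto.mono_left nhdsWithin_le_nhds
      exact ((hct.eventually (lt_mem_nhds hc)).and self_mem_nhdsWithin).exists
    obtain ⟨t, htB, hlt⟩ := exists_lt_of_lt_csSup ⟨s, hsB⟩ hc'lt
    calc c < ENNReal.ofReal (2 * ε * (c' - s)) := hc'
      _ ≤ ENNReal.ofReal (2 * ε * (t - s)) := ENNReal.ofReal_le_ofReal (by nlinarith)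
      _ ≤ ∫⁻ x in Ioc s t, f x := htB.2
      _ ≤ ∫⁻ x in Ioc s b, f x :=
          lintegral_mono_set (Ioc_subset_Ioc_right (le_csSup hbdd htB))
  obtain ⟨σ, hσ, hlt⟩ := hcon b (hsN.trans hsb)
  have hmem : b + σ ∈ B := by
    refine ⟨by linarith, ?_⟩
    rw [← Ioc_union_Ioc_eq_Ioc hsb (by linarith : b ≤ b + σ),
      lintegral_union measurableSet_Ioc (Ioc_disjoint_Ioc_of_le le_rfl),
      show 2 * ε * (b + σ - s) = 2 * ε * (b - s) + 2 * ε * σ by ring,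
      ENNReal.ofReal_add (mul_nonneg (by positivity) (by linarith)) (by positivity)]
    exact add_le_add hbB.2 hlt.le
  have := le_csSup hbdd hmem
  linarith

theorem corollary2p2 (ψ ψt : ℝ → ℝ → ℝ) (hψ : IsGlobalWaveMap ψ ψt) :
    Tendsto
      (fun A : ℝ =>
        limsup
          (fun T : ℝ => (∫⁻ t in Ioc A T, kineticEnergy ψt t (t - A)) / ENNReal.ofReal T)
          atTop)
      atTop (𝓝 0) ∧
    ∀ A : ℝ → ℝ, (∀ t, 0 < t → 0 < A t ∧ A t ≤ t) → MonotoneOn A (Ioi 0) →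
      Tendsto A atTop atTop →
      ∃ τ : ℕ → ℝ, (∀ n, 0 < τ n) ∧ Tendsto τ atTop atTop ∧
        Tendsto
          (fun n => ⨆ σ ∈ Ioi (0 : ℝ),
            (∫⁻ t in Ioc (τ n) (τ n + σ), kineticEnergy ψt t (t - A (τ n)))
              / ENNReal.ofReal σ)
          atTop (𝓝 0) := by
  constructor
  · rw [ENNReal.tendsto_nhds_zero]
    intro ε hε
    obtain ⟨δ, -, hδ0, hδε⟩ := ENNReal.lt_iff_exists_real_btwn.1 hε
    have hδ : 0 < δ := by simpa using hδ0
    obtain ⟨A₀, -, hA₀⟩ := hψ.exists_lintegral_kineticEnergy_le hδ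
    filter_upwards [eventually_ge_atTop A₀] with A hA
    obtain ⟨S₀, hS₀⟩ := hA₀ A hA
    refine (limsup_le_of_le (h := ?_)).trans hδε.le
    filter_upwards [eventually_ge_atTop S₀, eventually_gt_atTop 0] with S hS hS0
    rw [ENNReal.div_le_iff (by simpa using hS0) ENNReal.ofReal_ne_top,
      ← ENNReal.ofReal_mul hδ.le]
    exact hS₀ S hS
  · intro A _ _ hA
    have hτ : ∀ n : ℕ, ∃ τ, (n : ℝ) + 1 ≤ τ ∧ ∀ σ, 0 < σ →
        ∫⁻ t in Ioc τ (τ + σ), kineticEnergy ψt t (t - A τ)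
          ≤ ENNReal.ofReal (2 * (1 / ((n : ℝ) + 1)) * σ) := by
      intro n
      have hn : 0 < 1 / ((n : ℝ) + 1) := by positivity
      obtain ⟨A₀, -, hA₀⟩ := hψ.exists_lintegral_kineticEnergy_le hn
      obtain ⟨S₀, hS₀⟩ := hA₀ A₀ le_rfl
      obtain ⟨N, hN⟩ := eventually_atTop.1 (hA.eventually_ge_atTop A₀)
      obtain ⟨τ, hτ, hle⟩ := exists_forward_averages_le hn hS₀ (max N (n + 1))
      refine ⟨τ, (le_max_right _ _).trans hτ, fun σ hσ => le_trans ?_ (hle σ hσ)⟩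
      refine lintegral_mono fun t => lintegral_mono_set (Ioo_subset_Ioo_right ?_)
      have := hN τ ((le_max_left _ _).trans hτ)
      linarith
    choose τ hτ1 hτ2 using hτ
    refine ⟨τ, fun n => lt_of_lt_of_le (by positivity) (hτ1 n), ?_, ?_⟩
    · exact tendsto_atTop_mono (fun n => (le_add_of_nonneg_right zero_le_one).trans (hτ1 n))
        tendsto_natCast_atTop_atTop
    · have hlim : Tendsto (fun n : ℕ => ENNReal.ofReal (2 * (1 / ((n : ℝ) + 1)))) atTop (𝓝 0) := by
        have := ENNReal.tendsto_ofReal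
          ((tendsto_one_div_add_atTop_nhds_zero_nat (𝕜 := ℝ)).const_mul 2)
        simpa using this
      refine tendsto_of_tendsto_of_tendsto_of_le_of_le tendsto_const_nhds hlim
        (fun _ => zero_le) fun n => iSup₂_le fun σ hσ => ?_
      have hσ0 : 0 < σ := hσ
      rw [ENNReal.div_le_iff (by simpa using hσ0) ENNReal.ofReal_ne_top,
        ← ENNReal.ofReal_mul (by positivity)]
      exact hτ2 n σ hσ0
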